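/- Throughout, manifolds are smooth and Hausdorff and have no boundary. A linear connection $\nabla$ on a manifold $M$ is a smooth covariant derivative on $TM$; it is not assumed to be torsion-free. A semi-Riemannian metric $g$ on $M$ is a smooth field of symmetric non-degenerate bilinear forms on the tangent spaces of $M$, of arbitrary signature; it is parallel with respect to $\nabla$ if $X(g(Y,Z)) = g(\nabla_X Y, Z) + g(Y, \nabla_X Z)$ for all vector fields $X, Y, Z$. Metrics are independent if they are linearly independent over $\mathbb{R}$ as tensor fields on $M$. The holonomy group $\Psi(x)$ of $\nabla$ at $x \in M$ is the group of all automorphisms of $T_xM$ that are given by $\nabla$-parallel transport along piecewise smooth loops at $x$. On a connected manifold $M$, $\nabla$ has reducible holonomy if for some point (equivalently, for every point) $x \in M$ there is a $\Psi(x)$-invariant subspace $W$ of $T_xM$ with $0 \neq W \neq T_xM$. (i) Let $M$ be a simply connected (in particular connected) four-dimensional manifold. Let $g_1$ and $g_2$ be two independent semi-Riemannian metrics on $M$, parallel with respect to a linear connection $\nabla$ on $M$. Then $\nabla$ has reducible holonomy. (ii) Let $M$ be a connected four-dimensional manifold. Let $g_1$, $g_2$ and $g_3$ be three independent semi-Riemannian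 metrics on $M$, parallel with respect to a linear connection $\nabla$ on $M$. Then $\nabla$ has reducible holonomy. -/

import Mathlib

open Set Bundle
open scoped Manifold ContDiff Topology

noncomputable section

/-- A group `G` acting on the `F`-vector space `V` acts reducibly if there is a proper non-trivial
`G`-invariant subspace of `V`. -/
def ActsReducibly (F V G : Type*) [Field F] [AddCommGroup V] [Module F V] [Group G]
    [MulAction G V] : Prop :=
  ∃ W : Submodule F V, W ≠ ⊥ ∧ W ≠ ⊤ ∧ ∀ (g : G), ∀ ξ ∈ W, g • ξ ∈ W

section

variable {E : Type*} [NormedAddCommGroup E] [NormedSpace ℝ E]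
  {H : Type*} [TopologicalSpace H] (I : ModelWithCorners ℝ E H)
  (M : Type*) [TopologicalSpace M] [ChartedSpace H M] [IsManifold I ∞ M]

/-- A semi-Riemannian metric on `M`: a smooth field of symmetric non-degenerate bilinear forms on
the tangent spaces.  (On a connected manifold its signature is automatically constant.) -/
structure SemiRiemannianMetric where
  /-- the bilinear form on each tangent space -/
  form : ∀ x : M, TangentSpace I x →L[ℝ] TangentSpace I x →L[ℝ] ℝ
  symm : ∀ (x : M) (v w : TangentSpace I x), form x v w = form x w v
  nondegenerate : ∀ (x : M) (v : TangentSpace I x), (∀ w, form x v w = 0) → v = 0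
  smooth : ContMDiff I (I.prod 𝓘(ℝ, E →L[ℝ] E →L[ℝ] ℝ)) ∞
    (fun x : M ↦ TotalSpace.mk' (E →L[ℝ] E →L[ℝ] ℝ)
      (E := fun x : M ↦ TangentSpace I x →L[ℝ] TangentSpace I x →L[ℝ] ℝ) x (form x))

variable {I M}

/-- The metrics `g i` are independent: they are linearly independent over `ℝ` as tensor fields. -/
def SemiRiemannianMetric.Independent {ι : Type*} (g : ι → SemiRiemannianMetric I M) : Prop :=
  LinearIndependent ℝ fun (i : ι) (x : M) (v w : TangentSpace I x) ↦ (g i).form x v w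

/-- The metric `g` is parallel for the linear connection `cov`:
`X (g(σ, τ)) = g(∇_X σ, τ) + g(σ, ∇_X τ)` at every point `x`, for every tangent vector `X` at `x`
and all vector fields `σ`, `τ` differentiable at `x`. -/
def SemiRiemannianMetric.IsParallel (g : SemiRiemannianMetric I M)
    (cov : CovariantDerivative I E (TangentSpace I : M → Type _)) : Prop :=
  ∀ (x : M) (X : TangentSpace I x) (σ τ : ∀ y : M, TangentSpace I y),
    MDiffAt (T% σ) x → MDiffAt (T% τ) x →
      mvfderiv I (fun y ↦ g.form y (σ y) (τ y)) x X =
        g.form x (cov σ x X) (τ x) + g.form x (σ x) (cov τ x X)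

/-- The vector field `Y` along the curve `γ : [0, 1] → M` is parallel for the linear connection
`cov`.  At the time `t`, use the trivialization of `TM` given by the chart at `γ t`.  With `y` the
coordinate expression of `Y` and `e` the vector field with constant coordinates `y t`, the
covariant derivative of `Y` along `γ` at `t` has the coordinates `y' t + ∇_{γ' t} e`; it has to
vanish. -/
def IsParallelAlong (cov : CovariantDerivative I E (TangentSpace I : M → Type _))
    (γ : ℝ → M) (Y : ∀ t : ℝ, TangentSpace I (γ t)) : Prop :=
  ∀ t ∈ Icc (0 : ℝ) 1,
    HasDerivWithinAt
      (fun s ↦ (trivializationAt E (TangentSpace I : M → Type _) (γ t)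
        (TotalSpace.mk' E (γ s) (Y s))).2)
      (-(trivializationAt E (TangentSpace I : M → Type _) (γ t)
        (TotalSpace.mk' E (γ t)
          (cov (FiberBundle.extend E (Y t)) (γ t)
            (mfderivWithin 𝓘(ℝ, ℝ) I γ (Icc 0 1) t (1 : ℝ))))).2)
      (Icc 0 1) t

/-- `φ : T_xM → T_yM` is the parallel transport along the smooth curve `γ : [0, 1] → M` from `x`
to `y`: every `v` in `T_xM` is the initial value of a parallel field along `γ` whose final value is
`φ v`. -/
structure IsParallelTransportAlong (cov : CovariantDerivative I E (TangentSpace I : M → Type _))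
    (γ : ℝ → M) {x y : M} (φ : TangentSpace I x ≃ₗ[ℝ] TangentSpace I y) : Prop where
  smooth : ContMDiffOn 𝓘(ℝ, ℝ) I ∞ γ (Icc 0 1)
  source : γ 0 = x
  target : γ 1 = y
  transport : ∀ v : TangentSpace I x, ∃ Y : ∀ t : ℝ, TangentSpace I (γ t),
    IsParallelAlong cov γ Y ∧
      TotalSpace.mk' E (γ 0) (Y 0) = TotalSpace.mk' E x v ∧
      TotalSpace.mk' E (γ 1) (Y 1) = TotalSpace.mk' E y (φ v)

/-- Parallel transport along piecewise smooth curves: the composites of the parallel transports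
along finitely many successive smooth curves. -/
inductive IsParallelTransport (cov : CovariantDerivative I E (TangentSpace I : M → Type _)) :
    ∀ {x y : M}, (TangentSpace I x ≃ₗ[ℝ] TangentSpace I y) → Prop
  | refl (x : M) : IsParallelTransport cov (LinearEquiv.refl ℝ (TangentSpace I x))
  | trans {x y z : M} {φ : TangentSpace I x ≃ₗ[ℝ] TangentSpace I y}
      {ψ : TangentSpace I y ≃ₗ[ℝ] TangentSpace I z} (γ : ℝ → M)
      (hφ : IsParallelTransport cov φ) (hψ : IsParallelTransportAlong cov γ ψ) :
      IsParallelTransport cov (φ.trans ψ)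

/-- The time reversal of a parallel field is parallel along the reversed curve. -/
theorem IsParallelAlong.reverse {cov : CovariantDerivative I E (TangentSpace I : M → Type _)}
    {γ : ℝ → M} {Y : ∀ t : ℝ, TangentSpace I (γ t)}
    (hγ : ContMDiffOn 𝓘(ℝ, ℝ) I ∞ γ (Icc 0 1)) (hY : IsParallelAlong cov γ Y) :
    IsParallelAlong cov (fun t ↦ γ (1 - t)) (fun t ↦ Y (1 - t)) := by
  intro t ht
  have ht' : 1 - t ∈ Icc (0 : ℝ) 1 := ⟨by linarith [ht.2], by linarith [ht.1]⟩
  have hmaps : MapsTo (fun s : ℝ ↦ 1 - s) (Icc 0 1) (Icc 0 1) :=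
    fun s hs ↦ ⟨by linarith [hs.2], by linarith [hs.1]⟩
  have hsub : HasDerivWithinAt (fun s : ℝ ↦ 1 - s) (-1) (Icc 0 1) t := by
    simpa using (hasDerivWithinAt_id t (Icc (0 : ℝ) 1)).const_sub 1
  have hvel : mfderivWithin 𝓘(ℝ, ℝ) I (fun s ↦ γ (1 - s)) (Icc 0 1) t (1 : ℝ) =
      -(mfderivWithin 𝓘(ℝ, ℝ) I γ (Icc 0 1) (1 - t) (1 : ℝ)) := by
    have h1 : HasMFDerivWithinAt 𝓘(ℝ, ℝ) I γ (Icc 0 1) (1 - t)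
        (mfderivWithin 𝓘(ℝ, ℝ) I γ (Icc 0 1) (1 - t)) :=
      ((hγ (1 - t) ht').mdifferentiableWithinAt (by simp)).hasMFDerivWithinAt
    have h2 := h1.comp t hsub.hasFDerivWithinAt.hasMFDerivWithinAt hmaps
    have hu : UniqueMDiffWithinAt 𝓘(ℝ, ℝ) (Icc (0 : ℝ) 1) t :=
      ((uniqueDiffOn_Icc (zero_lt_one' ℝ)) t ht).uniqueMDiffWithinAt
    have h3 := h2.mfderivWithin hu
    have h4 := congrArg (fun L ↦ L (1 : ℝ)) h3
    refine h4.trans ?_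
    have h5 : (1 : ℝ) • (-1 : ℝ) = -1 := one_smul ℝ _
    exact (congrArg (fun r : ℝ ↦ mfderivWithin 𝓘(ℝ, ℝ) I γ (Icc 0 1) (1 - t) r) h5).trans
      (map_neg (mfderivWithin 𝓘(ℝ, ℝ) I γ (Icc 0 1) (1 - t)) (1 : ℝ))
  have key := (hY (1 - t) ht').scomp t hsub hmaps
  refine key.congr_deriv ?_
  rw [hvel, map_neg]
  have hlin : ∀ w : TangentSpace I (γ (1 - t)),
      (trivializationAt E (TangentSpace I : M → Type _) (γ (1 - t))
        (TotalSpace.mk' E (γ (1 - t)) (-w))).2 =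
      -(trivializationAt E (TangentSpace I : M → Type _) (γ (1 - t))
        (TotalSpace.mk' E (γ (1 - t)) w)).2 := fun w ↦
    ((trivializationAt E (TangentSpace I : M → Type _) (γ (1 - t))).linear ℝ
      (FiberBundle.mem_baseSet_trivializationAt' (γ (1 - t)))).map_neg w
  rw [hlin]
  simp

theorem IsParallelTransportAlong.reverse
    {cov : CovariantDerivative I E (TangentSpace I : M → Type _)} {γ : ℝ → M} {x y : M}
    {φ : TangentSpace I x ≃ₗ[ℝ] TangentSpace I y} (h : IsParallelTransportAlong cov γ φ) :
    IsParallelTransportAlong cov (fun t ↦ γ (1 - t)) φ.symm where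
  smooth := by
    refine h.smooth.comp (t := Icc (0 : ℝ) 1) (f := fun s : ℝ ↦ 1 - s) ?_
      (fun s hs ↦ ⟨by linarith [hs.2], by linarith [hs.1]⟩)
    exact (contDiff_const.sub contDiff_id).contMDiff.contMDiffOn
  source := by simpa using h.target
  target := by simpa using h.source
  transport v := by
    obtain ⟨Y, hY, h0, h1⟩ := h.transport (φ.symm v)
    refine ⟨fun t ↦ Y (1 - t), hY.reverse h.smooth, ?_, ?_⟩
    · have e : TotalSpace.mk' E (γ (1 - 0)) (Y (1 - 0)) = TotalSpace.mk' E (γ 1) (Y 1) :=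
        congrArg (fun r : ℝ ↦ TotalSpace.mk' E (γ r) (Y r)) (sub_zero (1 : ℝ))
      rw [LinearEquiv.apply_symm_apply] at h1
      exact e.trans h1
    · have e : TotalSpace.mk' E (γ (1 - 1)) (Y (1 - 1)) = TotalSpace.mk' E (γ 0) (Y 0) :=
        congrArg (fun r : ℝ ↦ TotalSpace.mk' E (γ r) (Y r)) (sub_self (1 : ℝ))
      exact e.trans h0

theorem IsParallelTransport.comp {cov : CovariantDerivative I E (TangentSpace I : M → Type _)}
    {x y z : M} {φ : TangentSpace I x ≃ₗ[ℝ] TangentSpace I y}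
    {ψ : TangentSpace I y ≃ₗ[ℝ] TangentSpace I z} (hφ : IsParallelTransport cov φ)
    (hψ : IsParallelTransport cov ψ) : IsParallelTransport cov (φ.trans ψ) := by
  induction hψ with
  | refl => exact hφ
  | trans γ _ hγ ih =>
    have h := IsParallelTransport.trans γ ih hγ
    exact h

theorem IsParallelTransport.inv {cov : CovariantDerivative I E (TangentSpace I : M → Type _)}
    {x y : M} {φ : TangentSpace I x ≃ₗ[ℝ] TangentSpace I y} (hφ : IsParallelTransport cov φ) :
    IsParallelTransport cov φ.symm := by
  induction hφ with
  | refl => exact IsParallelTransport.refl _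
  | trans γ _ hγ ih =>
    exact ((IsParallelTransport.refl _).trans _ hγ.reverse).comp ih

/-- The holonomy group at `x` of the linear connection `cov`: the automorphisms of `T_xM` that are
parallel transports along piecewise smooth loops at `x`. -/
def holonomyGroup (cov : CovariantDerivative I E (TangentSpace I : M → Type _)) (x : M) :
    Subgroup (TangentSpace I x ≃ₗ[ℝ] TangentSpace I x) where
  carrier := {φ | IsParallelTransport cov φ}
  one_mem' := IsParallelTransport.refl x
  mul_mem' hφ hψ := IsParallelTransport.comp hψ hφ
  inv_mem' hφ := IsParallelTransport.inv hφ

/-- The linear connection `cov` has reducible holonomy: its holonomy groups act reducibly on the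
tangent spaces.  (On a connected manifold this holds at all points as soon as it holds at one.) -/
def HasReducibleHolonomy (cov : CovariantDerivative I E (TangentSpace I : M → Type _)) : Prop :=
  ∀ x : M, ActsReducibly ℝ (TangentSpace I x) (holonomyGroup cov x)

end

end

section InvariantSubspace

variable {V : Type*} [AddCommGroup V] [Module ℝ V]

/-- The endomorphisms in `Φ` have a common proper non-trivial invariant subspace. -/
def HasInvariantSubspace (Φ : Set (Module.End ℝ V)) : Prop :=
  ∃ W : Submodule ℝ V, W ≠ ⊥ ∧ W ≠ ⊤ ∧ ∀ φ ∈ Φ, ∀ ξ ∈ W, φ ξ ∈ W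

theorem HasInvariantSubspace.of_commute {Φ : Set (Module.End ℝ V)} (T : Module.End ℝ V)
    (hT : ∀ φ ∈ Φ, Commute φ T) (hbot : LinearMap.ker T ≠ ⊥) (h0 : T ≠ 0) :
    HasInvariantSubspace Φ := by
  refine ⟨LinearMap.ker T, hbot, fun h ↦ h0 (LinearMap.ker_eq_top.mp h), fun φ hφ ξ hξ ↦ ?_⟩
  have h1 := LinearMap.congr_fun (hT φ hφ).eq ξ
  simp only [Module.End.mul_apply, LinearMap.mem_ker] at h1 hξ ⊢
  rw [← h1, hξ, map_zero]

/-- A non-scalar endomorphism commuting with `Φ` yields an invariant subspace, or else it is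
a real affine function of a complex structure. -/
theorem hasInvariantSubspace_or_sq_eq [FiniteDimensional ℝ V] [Nontrivial V]
    {Φ : Set (Module.End ℝ V)} (A : Module.End ℝ V) (hA : ∀ c : ℝ, A ≠ c • 1)
    (hΦ : ∀ φ ∈ Φ, Commute φ A) :
    HasInvariantSubspace Φ ∨
      ∃ α β : ℝ, β ≠ 0 ∧ (A - α • 1) * (A - α • 1) = -(β ^ 2) • (1 : Module.End ℝ V) := by
  have hint : IsIntegral ℝ A := Algebra.IsIntegral.isIntegral A
  have hnu : ¬ IsUnit (minpoly ℝ A) := minpoly.not_isUnit ℝ A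
  obtain ⟨p, hp, q, hq⟩ := WfDvdMonoid.exists_irreducible_factor hnu (minpoly.ne_zero hint)
  have hcomm : ∀ φ ∈ Φ, Commute φ (Polynomial.aeval A p) := fun φ hφ ↦ by
    have : A ∈ Subalgebra.centralizer ℝ {φ} := by
      rw [Subalgebra.mem_centralizer_iff]
      rintro g rfl
      exact (hΦ g hφ).eq
    have h3 := Polynomial.aeval_mem_adjoin_singleton ℝ A (p := p)
    have h4 : Algebra.adjoin ℝ {A} ≤ Subalgebra.centralizer ℝ {φ} :=
      Algebra.adjoin_le (Set.singleton_subset_iff.mpr this)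
    exact (Subalgebra.mem_centralizer_iff ℝ).mp (h4 h3) φ rfl
  have hker : LinearMap.ker (Polynomial.aeval A p) ≠ ⊥ := fun hbot ↦ by
    have h0 : Polynomial.aeval A q = 0 := by
      have h1 : Polynomial.aeval A p * Polynomial.aeval A q = 0 := by
        rw [← map_mul, ← hq, minpoly.aeval]
      ext x
      have h2 := LinearMap.congr_fun h1 x
      exact LinearMap.ker_eq_bot'.mp hbot _ h2
    have hd := minpoly.dvd ℝ A h0
    rw [hq] at hd
    have hq0 : q ≠ 0 := by
      rintro rfl
      exact minpoly.ne_zero hint (by simpa using hq)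
    have := (mul_dvd_mul_iff_right hq0 (a := p) (b := 1)).mp (by simpa using hd)
    exact hp.not_isUnit (isUnit_of_dvd_one this)
  by_cases hp0 : Polynomial.aeval A p = 0
  swap
  · exact Or.inl (.of_commute _ hcomm hker hp0)
  right
  have hdeg : p.natDegree ≤ 2 := hp.natDegree_le_two
  obtain ⟨a, b, c, rfl⟩ : ∃ a b c : ℝ, p = Polynomial.C a * Polynomial.X ^ 2 +
      Polynomial.C b * Polynomial.X + Polynomial.C c :=
    ⟨_, _, _, Polynomial.eq_quadratic_of_degree_le_two
      (Polynomial.degree_le_of_natDegree_le hdeg)⟩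
  have hpA : a • (A * A) + b • A + c • (1 : Module.End ℝ V) = 0 := by
    have := hp0
    simp only [map_add, map_mul, Polynomial.aeval_C, Polynomial.aeval_X,
      Algebra.algebraMap_eq_smul_one, smul_mul_assoc, one_mul, pow_two] at this
    exact this
  have ha : a ≠ 0 := by
    rintro rfl
    by_cases hb : b = 0
    · subst hb
      have : c = 0 := by
        by_contra hc
        have h1 : c • (1 : Module.End ℝ V) = 0 := by simpa using hpA
        rcases smul_eq_zero.mp h1 with h | h
        · exact hc h
        · exact one_ne_zero h
      subst this
      exact hp.ne_zero (by simp)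
    · refine hA (-(c / b)) ?_
      have h1 : b • A = -(c • (1 : Module.End ℝ V)) := by
        rw [zero_smul, zero_add] at hpA
        exact eq_neg_of_add_eq_zero_left hpA
      calc A = b⁻¹ • (b • A) := by rw [smul_smul, inv_mul_cancel₀ hb, one_smul]
        _ = _ := by rw [h1, smul_neg, smul_smul, neg_smul]; congr 2; field_simp
  have hdisc : b ^ 2 - 4 * a * c < 0 := by
    by_contra hge
    push Not at hge
    set r := (-b + √(b ^ 2 - 4 * a * c)) / (2 * a) with hr
    have hs : √(b ^ 2 - 4 * a * c) ^ 2 = b ^ 2 - 4 * a * c := Real.sq_sqrt hge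
    have hroot : (Polynomial.C a * Polynomial.X ^ 2 + Polynomial.C b * Polynomial.X +
        Polynomial.C c).IsRoot r := by
      simp only [Polynomial.IsRoot, Polynomial.eval_add, Polynomial.eval_mul, Polynomial.eval_C,
        Polynomial.eval_pow, Polynomial.eval_X, hr]
      generalize √(b ^ 2 - 4 * a * c) = s at hs
      field_simp
      linear_combination hs
    have h1 := Polynomial.degree_eq_one_of_irreducible_of_root hp hroot
    rw [Polynomial.degree_quadratic ha] at h1
    norm_num at h1
  refine ⟨-b / (2 * a), √(4 * a * c - b ^ 2) / (2 * a), ?_, ?_⟩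
  · have : 0 < √(4 * a * c - b ^ 2) := Real.sqrt_pos.mpr (by linarith)
    positivity
  · rw [div_pow, Real.sq_sqrt (by linarith)]
    have h1 : A * A = (-(b / a)) • A + (-(c / a)) • (1 : Module.End ℝ V) := by
      have h2 : A * A = a⁻¹ • (a • (A * A)) := by rw [smul_smul, inv_mul_cancel₀ ha, one_smul]
      have h3 : a • (A * A) = -(b • A) - c • (1 : Module.End ℝ V) := by
        rw [eq_sub_iff_add_eq, eq_neg_iff_add_eq_zero, ← hpA]; abel
      rw [h2, h3]
      module
    simp only [sub_mul, mul_sub, smul_mul_assoc, mul_smul_comm, one_mul, mul_one, h1]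
    match_scalars
    · field_simp; ring
    · field_simp; ring

end InvariantSubspace

section Skew

variable {V : Type*} [AddCommGroup V] [Module ℝ V]

/-- A complex structure `J` that is self-adjoint for the non-degenerate symmetric form `b` on a
four-dimensional real vector space. -/
structure IsSelfAdjointComplex (b : LinearMap.BilinForm ℝ V) (J : Module.End ℝ V) : Prop where
  finrank : Module.finrank ℝ V = 4
  symm : ∀ u v, b u v = b v u
  nondegenerate : ∀ v, (∀ w, b v w = 0) → v = 0
  sq : ∀ u, J (J u) = -u
  adj : ∀ u v, b (J u) v = b u (J v)

/-- `D` is complex linear for `J` and skew-adjoint for `b`. -/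
structure IsComplexSkew (b : LinearMap.BilinForm ℝ V) (J D : Module.End ℝ V) : Prop where
  comm : ∀ u, D (J u) = J (D u)
  skew : ∀ u v, b (D u) v = -b u (D v)

namespace IsSelfAdjointComplex

variable {b : LinearMap.BilinForm ℝ V} {J D D' : Module.End ℝ V}

theorem smul_eq_zero_iff (h : IsSelfAdjointComplex b J) {x : V} (hx : x ≠ 0) {p q : ℝ}
    (hpq : p • x + q • J x = 0) : p = 0 ∧ q = 0 := by
  have h1 : (p ^ 2 + q ^ 2) • x = 0 := by
    have h2 : p • (p • x + q • J x) - q • J (p • x + q • J x) = 0 := by rw [hpq]; simp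
    rw [← h2]
    simp only [map_add, map_smul, h.sq]
    module
  have h3 : p ^ 2 + q ^ 2 = 0 := (smul_eq_zero.mp h1).resolve_right hx
  constructor <;> nlinarith [sq_nonneg p, sq_nonneg q]

theorem exists_eq_combination (h : IsSelfAdjointComplex b J) {x y : V} (hx : x ≠ 0)
    (hy : ∀ p q : ℝ, y ≠ p • x + q • J x) (w : V) :
    ∃ p q r s : ℝ, w = p • x + q • J x + r • y + s • J y := by
  have hli : LinearIndependent ℝ ![x, J x, y, J y] := by
    rw [Fintype.linearIndependent_iff]
    intro g hg
    simp only [Fin.sum_univ_four, Matrix.cons_val] at hg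
    have h1 : g 2 ^ 2 + g 3 ^ 2 = 0 := by
      by_contra hne
      set n := g 2 ^ 2 + g 3 ^ 2 with hn
      have h2 : g 2 • (g 0 • x + g 1 • J x + g 2 • y + g 3 • J y) -
          g 3 • J (g 0 • x + g 1 • J x + g 2 • y + g 3 • J y) = 0 := by rw [hg]; simp
      have h3 : n • y = -(g 2 * g 0 + g 3 * g 1) • x + (g 3 * g 0 - g 2 * g 1) • J x := by
        rw [← sub_eq_zero, ← h2]
        simp only [map_add, map_smul, h.sq, hn]
        module
      refine hy (-(g 2 * g 0 + g 3 * g 1) / n) ((g 3 * g 0 - g 2 * g 1) / n) ?_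
      have h4 : y = n⁻¹ • (n • y) := by rw [smul_smul, inv_mul_cancel₀ hne, one_smul]
      rw [h4, h3]
      module
    have h2 : g 2 = 0 := by nlinarith [sq_nonneg (g 2), sq_nonneg (g 3)]
    have h3 : g 3 = 0 := by nlinarith [sq_nonneg (g 2), sq_nonneg (g 3)]
    obtain ⟨h4, h5⟩ := h.smul_eq_zero_iff hx (p := g 0) (q := g 1) (by simpa [h2, h3] using hg)
    intro i
    fin_cases i <;> assumption
  have hspan := hli.span_eq_top_of_card_eq_finrank (by simp [h.finrank])
  have hw : w ∈ Submodule.span ℝ (Set.range ![x, J x, y, J y]) := hspan ▸ Submodule.mem_top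
  obtain ⟨c, hc⟩ := (Submodule.mem_span_range_iff_exists_fun ℝ).mp hw
  refine ⟨c 0, c 1, c 2, c 3, ?_⟩
  rw [← hc]
  simp [Fin.sum_univ_four]

theorem exists_not_mem (h : IsSelfAdjointComplex b J) (x : V) :
    ∃ y : V, ∀ p q : ℝ, y ≠ p • x + q • J x := by
  by_contra! hall
  have : FiniteDimensional ℝ V := .of_finrank_pos (by rw [h.finrank]; norm_num)
  have hs : Submodule.span ℝ (Set.range ![x, J x]) = ⊤ := by
    refine eq_top_iff.mpr fun w _ ↦ ?_
    obtain ⟨p, q, hw⟩ := hall w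
    rw [Submodule.mem_span_range_iff_exists_fun]
    exact ⟨![p, q], by simp [hw]⟩
  have h1 := finrank_range_le_card (R := ℝ) ![x, J x]
  rw [Set.finrank, hs, finrank_top, h.finrank] at h1
  simp at h1

theorem eq_zero_of_orthogonal (h : IsSelfAdjointComplex b J) {x y z : V} (hx : x ≠ 0)
    (hy : ∀ p q : ℝ, y ≠ p • x + q • J x) (h1 : b z x = 0) (h2 : b z (J x) = 0)
    (h3 : b z y = 0) (h4 : b z (J y) = 0) : z = 0 := by
  refine h.nondegenerate z fun w ↦ ?_
  obtain ⟨p, q, r, s, rfl⟩ := h.exists_eq_combination hx hy w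
  simp [h1, h2, h3, h4]

theorem exists_nonnull (h : IsSelfAdjointComplex b J) : ∃ x, b x x ≠ 0 := by
  by_contra! hall
  have h0 : ∀ v : V, v = 0 := fun v ↦ h.nondegenerate v fun w ↦ by
    have h1 := hall (v + w)
    simp only [map_add, LinearMap.add_apply, hall, h.symm w v] at h1
    linarith
  have : Subsingleton V := ⟨fun v w ↦ by rw [h0 v, h0 w]⟩
  have := h.finrank
  rw [Module.finrank_zero_of_subsingleton] at this
  norm_num at this

end IsSelfAdjointComplex

namespace IsComplexSkew

variable {b : LinearMap.BilinForm ℝ V} {J D D' : Module.End ℝ V}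

theorem apply_self (h : IsSelfAdjointComplex b J) (hD : IsComplexSkew b J D) (u : V) :
    b (D u) u = 0 := by
  have h1 := hD.skew u u
  rw [h.symm u] at h1
  linarith

theorem apply_J (h : IsSelfAdjointComplex b J) (hD : IsComplexSkew b J D) (u : V) :
    b (D u) (J u) = 0 := by
  have h1 := hD.skew u (J u)
  rw [hD.comm, ← h.adj u, h.symm (J u)] at h1
  linarith

theorem add (hD : IsComplexSkew b J D) (hD' : IsComplexSkew b J D') :
    IsComplexSkew b J (D + D') where
  comm u := by simp [hD.comm, hD'.comm]
  skew u v := by simp [hD.skew, hD'.skew]; ring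

theorem smul (hD : IsComplexSkew b J D) (p : ℝ) : IsComplexSkew b J (p • D) where
  comm u := by simp [hD.comm]
  skew u v := by simp [hD.skew]

theorem complex_smul (h : IsSelfAdjointComplex b J) (hD : IsComplexSkew b J D) (p q : ℝ) :
    IsComplexSkew b J (p • D + q • (J * D)) := by
  refine (hD.smul p).add (.smul ?_ q)
  refine ⟨fun u ↦ by simp [hD.comm], fun u v ↦ ?_⟩
  simp only [Module.End.mul_apply]
  rw [h.adj, hD.skew, hD.comm]

theorem eq_zero_of_apply_eq_zero (h : IsSelfAdjointComplex b J) (hD : IsComplexSkew b J D) {x : V}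
    (hx : x ≠ 0) (h0 : D x = 0) : D = 0 := by
  obtain ⟨y, hy⟩ := h.exists_not_mem x
  have h1 : D y = 0 := by
    refine h.eq_zero_of_orthogonal hx hy ?_ ?_ (hD.apply_self h y) (hD.apply_J h y)
    · rw [hD.skew, h0]; simp
    · rw [hD.skew, hD.comm, h0]; simp
  ext w
  obtain ⟨p, q, r, s, rfl⟩ := h.exists_eq_combination hx hy w
  simp [hD.comm, h0, h1]

theorem injective (h : IsSelfAdjointComplex b J) (hD : IsComplexSkew b J D) (h0 : D ≠ 0) {x : V}
    (hx : D x = 0) : x = 0 := by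
  by_contra hne
  exact h0 (hD.eq_zero_of_apply_eq_zero h hne hx)

/-- Complex skew endomorphisms of a complex plane form a complex line. -/
theorem eq_complex_smul (h : IsSelfAdjointComplex b J) (hD : IsComplexSkew b J D)
    (hD' : IsComplexSkew b J D') (h0 : D ≠ 0) : ∃ p q : ℝ, D' = p • D + q • (J * D) := by
  obtain ⟨x, hx⟩ := h.exists_nonnull
  have hx0 : x ≠ 0 := by rintro rfl; simp at hx
  have hDx : D x ≠ 0 := fun h1 ↦ hx0 (hD.injective h h0 h1)
  have hnot : ∀ p q : ℝ, D x ≠ p • x + q • J x := by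
    intro p q hpq
    have h1 := hD.apply_self h x
    have h2 := hD.apply_J h x
    rw [hpq] at h1 h2
    simp only [map_add, map_smul, LinearMap.add_apply, LinearMap.smul_apply, smul_eq_mul] at h1 h2
    have h3 : b (J x) (J x) = -b x x := by rw [h.adj, h.sq]; simp
    have h4 : b (J x) x = b x (J x) := h.adj x x
    rw [h4] at h1
    rw [h3] at h2
    have h5 : (p ^ 2 + q ^ 2) * b x x = 0 := by linear_combination p * h1 - q * h2
    have h6 : p ^ 2 + q ^ 2 = 0 := (mul_eq_zero.mp h5).resolve_right hx
    have hp : p = 0 := by nlinarith [sq_nonneg p, sq_nonneg q]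
    have hq : q = 0 := by nlinarith [sq_nonneg p, sq_nonneg q]
    exact hDx (by rw [hpq, hp, hq]; simp)
  obtain ⟨p, q, r, s, hw⟩ := h.exists_eq_combination hx0 hnot (D' x)
  have h1 := hD'.apply_self h x
  have h2 := hD'.apply_J h x
  have h3 : b (J x) (J x) = -b x x := by rw [h.adj, h.sq]; simp
  have h4 : b (J x) x = b x (J x) := h.adj x x
  have h5 : b (J (D x)) x = 0 := by rw [h.adj, hD.apply_J h]
  have h6 : b (J (D x)) (J x) = 0 := by rw [h.adj, h.sq, map_neg, hD.apply_self h, neg_zero]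
  rw [hw] at h1 h2
  simp only [map_add, map_smul, LinearMap.add_apply, LinearMap.smul_apply, smul_eq_mul,
    hD.apply_self h, hD.apply_J h, h5, h6, h3, h4] at h1 h2
  have h7 : (p ^ 2 + q ^ 2) * b x x = 0 := by linear_combination p * h1 - q * h2
  have h8 : p ^ 2 + q ^ 2 = 0 := (mul_eq_zero.mp h7).resolve_right hx
  have hp : p = 0 := by nlinarith [sq_nonneg p, sq_nonneg q]
  have hq : q = 0 := by nlinarith [sq_nonneg p, sq_nonneg q]
  refine ⟨r, s, ?_⟩
  have h9 := hD'.add ((hD.complex_smul h r s).smul (-1))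
  have h10 := h9.eq_zero_of_apply_eq_zero h hx0 (by simp [hw, hp, hq]; abel)
  rw [neg_one_smul, add_neg_eq_zero] at h10
  exact h10

theorem commute (h : IsSelfAdjointComplex b J) (hD : IsComplexSkew b J D)
    (hD' : IsComplexSkew b J D') : Commute D D' := by
  by_cases h0 : D = 0
  · rw [h0]; exact Commute.zero_left _
  obtain ⟨p, q, rfl⟩ := hD.eq_complex_smul h hD' h0
  have hJ : Commute D J := LinearMap.ext hD.comm
  exact ((Commute.refl D).smul_right p).add_right ((hJ.mul_right (Commute.refl D)).smul_right q)

theorem eq_or_eq_neg (h : IsSelfAdjointComplex b J) (hD : IsComplexSkew b J D)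
    (hD' : IsComplexSkew b J D') (h1 : ∀ u, D (D u) = -u) (h2 : ∀ u, D' (D' u) = -u) :
    D' = D ∨ D' = -D := by
  obtain ⟨x, hx⟩ := h.exists_nonnull
  have hx0 : x ≠ 0 := by rintro rfl; simp at hx
  have h0 : D ≠ 0 := by
    rintro rfl
    exact hx0 (by simpa using h1 x)
  obtain ⟨p, q, rfl⟩ := hD.eq_complex_smul h hD' h0
  have h3 := h2 x
  simp only [LinearMap.add_apply, LinearMap.smul_apply, Module.End.mul_apply, map_add, map_smul,
    hD.comm, h1, h.sq] at h3
  have h4 : (p ^ 2 - q ^ 2 - 1) • x + (2 * p * q) • J x = 0 := by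
    rw [map_neg] at h3
    rw [← sub_eq_zero.mpr h3.symm]
    module
  obtain ⟨h5, h6⟩ := h.smul_eq_zero_iff hx0 h4
  have hq : q = 0 := by
    rcases mul_eq_zero.mp h6 with h7 | h7
    · have hp : p = 0 := by linarith
      rw [hp] at h5
      nlinarith [sq_nonneg q]
    · exact h7
  have hp : (p - 1) * (p + 1) = 0 := by rw [hq] at h5; linarith
  rcases mul_eq_zero.mp hp with h7 | h7
  · left
    have : p = 1 := by linarith
    simp [this, hq]
  · right
    have : p = -1 := by linarith
    simp [this, hq]

/-- The square of a complex skew endomorphism is a complex scalar. -/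
theorem sq_eq (h : IsSelfAdjointComplex b J) (hD : IsComplexSkew b J D) :
    ∃ p q : ℝ, ∀ u, D (D u) = p • u + q • J u := by
  by_cases h0 : D = 0
  · exact ⟨0, 0, fun u ↦ by simp [h0]⟩
  have h3 : IsComplexSkew b J (D * D * D) := by
    refine ⟨fun u ↦ by simp [hD.comm], fun u v ↦ ?_⟩
    simp only [Module.End.mul_apply, hD.skew, neg_neg]
  obtain ⟨p, q, hpq⟩ := hD.eq_complex_smul h h3 h0
  refine ⟨p, q, fun u ↦ ?_⟩
  have h4 := LinearMap.congr_fun hpq u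
  simp only [Module.End.mul_apply, LinearMap.add_apply, LinearMap.smul_apply] at h4
  refine sub_eq_zero.mp (hD.injective h h0 ?_)
  rw [map_sub, h4, map_add, map_smul, map_smul, hD.comm, sub_self]

/-- A family of complex linear maps commuting with a complex skew square root of `-1` preserves
a null line. -/
theorem hasInvariantSubspace (h : IsSelfAdjointComplex b J) (hD : IsComplexSkew b J D)
    (h1 : ∀ u, D (D u) = -u) {Φ : Set (Module.End ℝ V)} (hJ : ∀ φ ∈ Φ, Commute φ J)
    (hΦ : ∀ φ ∈ Φ, Commute φ D) : HasInvariantSubspace Φ := by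
  obtain ⟨x, hx⟩ := h.exists_nonnull
  have hx0 : x ≠ 0 := by rintro rfl; simp at hx
  have key : ∀ s : ℝ, s ≠ 0 → D + s • J ≠ 0 := by
    intro s hs h2
    have h3 : ∀ u, D u = -(s • J u) := fun u ↦ by
      have := LinearMap.congr_fun h2 u
      exact eq_neg_of_add_eq_zero_left this
    have h4 := hD.apply_J h x
    rw [h3, map_neg, LinearMap.neg_apply, map_smul, LinearMap.smul_apply, h.adj, h.sq, map_neg,
      smul_eq_mul] at h4
    have : s * b x x = 0 := by linarith
    rcases mul_eq_zero.mp this with h5 | h5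
    · exact hs h5
    · exact hx h5
  refine .of_commute (D + (-1 : ℝ) • J) (fun φ hφ ↦ (hΦ φ hφ).add_right ((hJ φ hφ).smul_right _))
    (fun hbot ↦ ?_) (key _ (by norm_num))
  refine key 1 one_ne_zero (LinearMap.ext fun u ↦ ?_)
  refine LinearMap.ker_eq_bot'.mp hbot _ ?_
  simp only [LinearMap.add_apply, LinearMap.smul_apply, map_add, map_smul, h1, h.sq, hD.comm]
  module

end IsComplexSkew

end Skew

section Existence

variable {V : Type*} [AddCommGroup V] [Module ℝ V]

/-- The infinitesimal rotation in the complex plane spanned by `u` and `v`, for the complex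
bilinear form with real part `b`. -/
def complexRotation (b : LinearMap.BilinForm ℝ V) (J : Module.End ℝ V) (u v : V) :
    Module.End ℝ V :=
  (b u).smulRight v - ((b u).comp J).smulRight (J v) - (b v).smulRight u +
    ((b v).comp J).smulRight (J u)

theorem complexRotation_apply (b : LinearMap.BilinForm ℝ V) (J : Module.End ℝ V) (u v x : V) :
    complexRotation b J u v x =
      b u x • v - b u (J x) • J v - b v x • u + b v (J x) • J u := rfl

/-- The complex scalar by which the square of `complexRotation b J u v` acts. -/
def complexGram (b : LinearMap.BilinForm ℝ V) (J : Module.End ℝ V) (u v : V) : ℂ :=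
  ⟨b u v ^ 2 - b u (J v) ^ 2 - b u u * b v v + b u (J u) * b v (J v),
    -2 * b u v * b u (J v) + b u u * b v (J v) + b u (J u) * b v v⟩

variable {b : LinearMap.BilinForm ℝ V} {J : Module.End ℝ V}

theorem isComplexSkew_complexRotation (h : IsSelfAdjointComplex b J) (u v : V) :
    IsComplexSkew b J (complexRotation b J u v) where
  comm x := by
    simp only [complexRotation_apply, map_add, map_sub, map_smul, map_neg, h.sq]
    module
  skew x y := by
    simp only [complexRotation_apply, map_add, map_sub, map_smul, LinearMap.add_apply,
      LinearMap.sub_apply, LinearMap.smul_apply, smul_eq_mul]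
    rw [h.symm x v, h.symm x u, h.symm x (J v), h.symm x (J u), h.adj, h.adj, h.adj, h.adj]
    ring

theorem complexRotation_sq (h : IsSelfAdjointComplex b J) {u v : V} (hu : u ≠ 0) (x : V) :
    complexRotation b J u v (complexRotation b J u v x) =
      (complexGram b J u v).re • x + (complexGram b J u v).im • J x := by
  have hR := isComplexSkew_complexRotation h u v
  obtain ⟨p, q, hpq⟩ := hR.sq_eq h
  have h1 : complexRotation b J u v (complexRotation b J u v u) =
      (complexGram b J u v).re • u + (complexGram b J u v).im • J u := by
    have huv : b v u = b u v := h.symm v u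
    have h2 : b u (J v) = b v (J u) := by rw [← h.adj, h.symm]
    simp only [complexRotation_apply, map_add, map_sub, map_smul, h.sq, complexGram, map_neg, huv, h2]
    module
  rw [hpq] at h1
  have h2 : (p - (complexGram b J u v).re) • u + (q - (complexGram b J u v).im) • J u = 0 := by
    rw [← sub_eq_zero.mpr h1]
    module
  obtain ⟨h3, h4⟩ := h.smul_eq_zero_iff hu h2
  rw [hpq, sub_eq_zero.mp h3, sub_eq_zero.mp h4]

theorem exists_complexGram_ne_zero (h : IsSelfAdjointComplex b J) :
    ∃ u v : V, u ≠ 0 ∧ complexGram b J u v ≠ 0 := by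
  obtain ⟨u, hu⟩ := h.exists_nonnull
  have hu0 : u ≠ 0 := by rintro rfl; simp at hu
  obtain ⟨v, hv⟩ := h.exists_not_mem u
  refine ⟨u, v, hu0, fun hz ↦ ?_⟩
  have hR := isComplexSkew_complexRotation h u v
  have h0 : complexRotation b J u v ≠ 0 := by
    intro h0
    have h1 : complexRotation b J u v u = 0 := by rw [h0]; rfl
    rw [complexRotation_apply] at h1
    have hn : b u u ^ 2 + b u (J u) ^ 2 ≠ 0 := by positivity
    set a := b u u
    set c := b u (J u)
    set m := b v u
    set n := b v (J u)
    refine hv ((a * m + c * n) / (a ^ 2 + c ^ 2)) ((c * m - a * n) / (a ^ 2 + c ^ 2)) ?_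
    have h2 : (a ^ 2 + c ^ 2) • v = (a * m + c * n) • u + (c * m - a * n) • J u := by
      have h3 : a • (a • v - c • J v - m • u + n • J u) +
          c • J (a • v - c • J v - m • u + n • J u) = 0 := by rw [h1]; simp
      rw [← sub_eq_zero, ← h3]
      simp only [map_add, map_sub, map_smul, h.sq]
      module
    have h4 : v = (a ^ 2 + c ^ 2)⁻¹ • ((a ^ 2 + c ^ 2) • v) := by
      rw [smul_smul, inv_mul_cancel₀ hn, one_smul]
    rw [h4, h2]
    module
  have h1 := complexRotation_sq h (v := v) hu0 u
  rw [hz] at h1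
  simp only [Complex.zero_re, Complex.zero_im, zero_smul, add_zero] at h1
  exact hu0 (hR.injective h h0 (hR.injective h h0 h1))

theorem isComplexSkew_normalize (h : IsSelfAdjointComplex b J) {u v : V} (hu : u ≠ 0) {w : ℂ}
    (hw : w ^ 2 * complexGram b J u v = -1) :
    IsComplexSkew b J (w.re • complexRotation b J u v + w.im • (J * complexRotation b J u v)) ∧
    ∀ x, (w.re • complexRotation b J u v + w.im • (J * complexRotation b J u v))
      ((w.re • complexRotation b J u v + w.im • (J * complexRotation b J u v)) x) = -x := by
  have hR := isComplexSkew_complexRotation h u v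
  refine ⟨hR.complex_smul h _ _, fun x ↦ ?_⟩
  have h1 := congrArg Complex.re hw
  have h2 := congrArg Complex.im hw
  simp only [pow_two, Complex.mul_re, Complex.mul_im, Complex.neg_re, Complex.neg_im,
    Complex.one_re, Complex.one_im, neg_zero] at h1 h2
  simp only [LinearMap.add_apply, LinearMap.smul_apply, Module.End.mul_apply, map_add, map_smul,
    map_neg, hR.comm, h.sq, complexRotation_sq h hu]
  have h3 : -x = (-1 : ℝ) • x + (0 : ℝ) • J x := by simp
  rw [h3]
  match_scalars
  · linear_combination h1
  · linear_combination h2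

/-- Near a non-zero complex number `z ↦ √(-1 / z)` has a continuous branch. -/
theorem exists_continuousAt_sq_mul_eq {z₀ : ℂ} (hz : z₀ ≠ 0) :
    ∃ w : ℂ → ℂ, ∀ᶠ z in 𝓝 z₀, ContinuousAt w z ∧ w z ^ 2 * z = -1 := by
  obtain ⟨w₀, hw₀⟩ := IsAlgClosed.exists_pow_nat_eq (-1 / z₀) (n := 2) (by norm_num)
  refine ⟨fun z ↦ w₀ * (z₀ / z) ^ (1 / 2 : ℂ), ?_⟩
  have h1 : ContinuousAt (fun z ↦ z₀ / z) z₀ := continuousAt_const.div continuousAt_id hz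
  have h2 : ∀ᶠ z in 𝓝 z₀, z₀ / z ∈ Complex.slitPlane :=
    h1.eventually_mem (Complex.isOpen_slitPlane.mem_nhds (by simp [div_self hz]))
  filter_upwards [h2, isOpen_ne.mem_nhds hz] with z hz1 hz2
  have hz2 : z ≠ 0 := hz2
  constructor
  · refine continuousAt_const.mul ?_
    exact (continuousAt_const.div continuousAt_id hz2).cpow continuousAt_const hz1
  · have h3 : ((z₀ / z) ^ (1 / 2 : ℂ)) ^ 2 = z₀ / z := by
      rw [← Complex.cpow_nat_mul]
      norm_num
    rw [mul_pow, h3, hw₀]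
    field_simp

theorem exists_isComplexSkew_root (h : IsSelfAdjointComplex b J) :
    ∃ D, IsComplexSkew b J D ∧ ∀ x, D (D x) = -x := by
  obtain ⟨u, v, hu, hz⟩ := exists_complexGram_ne_zero h
  obtain ⟨w, hw⟩ := exists_continuousAt_sq_mul_eq hz
  exact ⟨_, isComplexSkew_normalize h hu hw.self_of_nhds.2⟩

end Existence

section Forms

variable {V : Type*} [AddCommGroup V] [Module ℝ V]

theorem exists_operator [FiniteDimensional ℝ V] {b : LinearMap.BilinForm ℝ V}
    (hb : ∀ v, (∀ w, b v w = 0) → v = 0) (c : LinearMap.BilinForm ℝ V) :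
    ∃ A : Module.End ℝ V, ∀ u v, b (A u) v = c u v := by
  have hinj : Function.Injective b := by
    rw [injective_iff_map_eq_zero]
    exact fun v hv ↦ hb v fun w ↦ by rw [hv]; rfl
  let e := LinearMap.linearEquivOfInjective b hinj (Subspace.dual_finrank_eq).symm
  refine ⟨e.symm.toLinearMap ∘ₗ c, fun u v ↦ ?_⟩
  have h1 : b (e.symm (c u)) = c u := e.apply_symm_apply (c u)
  exact LinearMap.congr_fun h1 v

/-- An isometry for both forms intertwines the operators relating them. -/
theorem intertwine_operator {V' : Type*} [AddCommGroup V'] [Module ℝ V']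
    {b c : LinearMap.BilinForm ℝ V} {b' c' : LinearMap.BilinForm ℝ V'}
    (hb : ∀ v, (∀ w, b' v w = 0) → v = 0) {A : Module.End ℝ V} {A' : Module.End ℝ V'}
    (hA : ∀ u v, b (A u) v = c u v) (hA' : ∀ u v, b' (A' u) v = c' u v)
    (e : V ≃ₗ[ℝ] V') (he : ∀ u v, b' (e u) (e v) = b u v) (he' : ∀ u v, c' (e u) (e v) = c u v)
    (u : V) : e (A u) = A' (e u) := by
  refine sub_eq_zero.mp (hb _ fun w ↦ ?_)
  obtain ⟨v, rfl⟩ := e.surjective w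
  rw [map_sub, LinearMap.sub_apply, he, hA, hA', he', sub_self]

/-- Three independent invariant symmetric forms on a four-dimensional space, one of them
non-degenerate, force an invariant subspace. -/
theorem hasInvariantSubspace_of_three_forms {b₁ b₂ b₃ : LinearMap.BilinForm ℝ V}
    (hdim : Module.finrank ℝ V = 4) (hs₁ : ∀ u v, b₁ u v = b₁ v u)
    (hs₂ : ∀ u v, b₂ u v = b₂ v u) (hs₃ : ∀ u v, b₃ u v = b₃ v u)
    (hb : ∀ v, (∀ w, b₁ v w = 0) → v = 0)
    (hli : ∀ p q r : ℝ, (∀ u v, p * b₁ u v + q * b₂ u v + r * b₃ u v = 0) →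
      p = 0 ∧ q = 0 ∧ r = 0)
    {Φ : Set (Module.End ℝ V)}
    (hΦ : ∀ φ ∈ Φ, ∃ e : V ≃ₗ[ℝ] V, φ = e ∧ (∀ u v, b₁ (e u) (e v) = b₁ u v) ∧
      (∀ u v, b₂ (e u) (e v) = b₂ u v) ∧ (∀ u v, b₃ (e u) (e v) = b₃ u v)) :
    HasInvariantSubspace Φ := by
  by_contra hno
  have : FiniteDimensional ℝ V := .of_finrank_pos (by rw [hdim]; norm_num)
  have : Nontrivial V := Module.nontrivial_of_finrank_pos (R := ℝ) (by rw [hdim]; norm_num)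
  obtain ⟨A₂, hA₂⟩ := exists_operator hb b₂
  obtain ⟨A₃, hA₃⟩ := exists_operator hb b₃
  have hcA₂ : ∀ φ ∈ Φ, Commute φ A₂ := fun φ hφ ↦ by
    obtain ⟨e, rfl, h1, h2, -⟩ := hΦ φ hφ
    exact LinearMap.ext (intertwine_operator hb hA₂ hA₂ e h1 h2)
  have hcA₃ : ∀ φ ∈ Φ, Commute φ A₃ := fun φ hφ ↦ by
    obtain ⟨e, rfl, h1, -, h3⟩ := hΦ φ hφ
    exact LinearMap.ext (intertwine_operator hb hA₃ hA₃ e h1 h3)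
  have hsA₂ : ∀ u v, b₁ (A₂ u) v = b₁ u (A₂ v) := fun u v ↦ by
    rw [hA₂, hs₁ u, hA₂, hs₂]
  have hsA₃ : ∀ u v, b₁ (A₃ u) v = b₁ u (A₃ v) := fun u v ↦ by
    rw [hA₃, hs₁ u, hA₃, hs₃]
  have hind : ∀ p q r : ℝ, p • (1 : Module.End ℝ V) + q • A₂ + r • A₃ = 0 →
      p = 0 ∧ q = 0 ∧ r = 0 := fun p q r h0 ↦ hli p q r fun u v ↦ by
    have h1 := congrArg (fun T : Module.End ℝ V ↦ b₁ (T u) v) h0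
    simpa [hA₂, hA₃] using h1
  have hquad : ∀ T : Module.End ℝ V, (∀ c : ℝ, T ≠ c • 1) → (∀ φ ∈ Φ, Commute φ T) →
      ∃ α β : ℝ, β ≠ 0 ∧ (T - α • 1) * (T - α • 1) = -(β ^ 2) • (1 : Module.End ℝ V) :=
    fun T h1 h2 ↦ (hasInvariantSubspace_or_sq_eq T h1 h2).resolve_left hno
  obtain ⟨α, β, hβ, hJ⟩ := hquad A₂ (fun c hc ↦ by
    have := hind (-c) 1 0 (by rw [hc]; module)
    exact one_ne_zero this.2.1) hcA₂
  obtain ⟨α', β', hβ', hJ'⟩ := hquad A₃ (fun c hc ↦ by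
    have := hind (-c) 0 1 (by rw [hc]; module)
    exact one_ne_zero this.2.2) hcA₃
  have hsq : ∀ (T : Module.End ℝ V) (s : ℝ), s ≠ 0 → T * T = -(s ^ 2) • (1 : Module.End ℝ V) →
      (s⁻¹ • T) * (s⁻¹ • T) = -1 := fun T s hs hT ↦ by
    rw [smul_mul_smul_comm, hT, smul_smul, ← neg_one_smul ℝ (1 : Module.End ℝ V)]
    congr 1
    field_simp
  have hJ2 := hsq _ _ hβ hJ
  have hJ2' := hsq _ _ hβ' hJ'
  have hindJ : ∀ p q r : ℝ, p • (1 : Module.End ℝ V) + q • (β⁻¹ • (A₂ - α • 1)) +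
      r • (β'⁻¹ • (A₃ - α' • 1)) = 0 → p = 0 ∧ q = 0 ∧ r = 0 := fun p q r h0 ↦ by
    obtain ⟨h1, h2, h3⟩ := hind (p - q * β⁻¹ * α - r * β'⁻¹ * α') (q * β⁻¹) (r * β'⁻¹)
      (by rw [← h0]; module)
    have h4 : q = 0 := (mul_eq_zero.mp h2).resolve_right (inv_ne_zero hβ)
    have h5 : r = 0 := (mul_eq_zero.mp h3).resolve_right (inv_ne_zero hβ')
    refine ⟨?_, h4, h5⟩
    rw [h4, h5] at h1
    linarith
  have hcJ : ∀ φ ∈ Φ, Commute φ (β⁻¹ • (A₂ - α • 1)) := fun φ hφ ↦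
    ((hcA₂ φ hφ).sub_right ((Commute.one_right φ).smul_right α)).smul_right _
  have hcJ' : ∀ φ ∈ Φ, Commute φ (β'⁻¹ • (A₃ - α' • 1)) := fun φ hφ ↦
    ((hcA₃ φ hφ).sub_right ((Commute.one_right φ).smul_right α')).smul_right _
  have hsJ : ∀ u v, b₁ ((β⁻¹ • (A₂ - α • (1 : Module.End ℝ V))) u) v =
      b₁ u ((β⁻¹ • (A₂ - α • (1 : Module.End ℝ V))) v) := fun u v ↦ by
    simp [hsA₂]
  set J := β⁻¹ • (A₂ - α • (1 : Module.End ℝ V)) with hJdef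
  set J' := β'⁻¹ • (A₃ - α' • (1 : Module.End ℝ V)) with hJdef'
  clear_value J J'
  -- the anticommutator is a scalar
  obtain ⟨n, hn⟩ : ∃ n : ℝ, J * J' + J' * J = n • 1 := by
    obtain ⟨s, t, -, h1⟩ := hquad (J + J') (fun c hc ↦ by
      have := hindJ (-c) 1 1 (by rw [one_smul, one_smul, add_assoc, hc]; module)
      exact one_ne_zero this.2.1) (fun φ hφ ↦ (hcJ φ hφ).add_right (hcJ' φ hφ))
    obtain ⟨s', t', -, h2⟩ := hquad (J - J') (fun c hc ↦ by
      have := hindJ (-c) 1 (-1) (by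
        rw [one_smul, neg_one_smul, add_assoc, ← sub_eq_add_neg, hc]; module)
      exact one_ne_zero this.2.1) (fun φ hφ ↦ (hcJ φ hφ).sub_right (hcJ' φ hφ))
    have h3 : J * J' + J' * J = (2 * s) • (J + J') + (2 - s ^ 2 - t ^ 2) • 1 := by
      have h4 : (J + J' - s • 1) * (J + J' - s • 1) =
          J * J + J' * J' + (J * J' + J' * J) - (2 * s) • (J + J') + (s ^ 2) • 1 := by
        simp only [add_mul, mul_add, sub_mul, mul_sub, smul_mul_assoc, mul_smul_comm, one_mul,
          mul_one]
        module
      rw [h4, hJ2, hJ2'] at h1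
      rw [← sub_eq_zero, ← sub_eq_zero.mpr h1]
      module
    have h5 : J * J' + J' * J = (-2 * s') • (J - J') + (-2 + s' ^ 2 + t' ^ 2) • 1 := by
      have h4 : (J - J' - s' • 1) * (J - J' - s' • 1) =
          J * J + J' * J' - (J * J' + J' * J) - (2 * s') • (J - J') + (s' ^ 2) • 1 := by
        simp only [sub_mul, mul_sub, smul_mul_assoc, mul_smul_comm, one_mul, mul_one]
        module
      rw [h4, hJ2, hJ2'] at h2
      rw [← sub_eq_zero, ← neg_eq_zero, ← sub_eq_zero.mpr h2]
      module
    obtain ⟨-, h6, h7⟩ := hindJ (2 - s ^ 2 - t ^ 2 - (-2 + s' ^ 2 + t' ^ 2)) (2 * s + 2 * s')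
      (2 * s - 2 * s') (by rw [← sub_eq_zero.mpr (h3.symm.trans h5)]; module)
    have h8 : s = 0 := by linarith
    refine ⟨2 - s ^ 2 - t ^ 2, ?_⟩
    rw [h3, h8]
    module
  set K := J' + (n / 2) • J with hK
  have hanti : K * J = -(J * K) := by
    rw [eq_neg_iff_add_eq_zero, hK]
    simp only [add_mul, mul_add, smul_mul_assoc, mul_smul_comm, hJ2]
    rw [show J' * J + (n / 2) • (-1 : Module.End ℝ V) + (J * J' + (n / 2) • (-1)) =
      (J * J' + J' * J) - n • 1 by module, hn, sub_self]
  have hcK : ∀ φ ∈ Φ, Commute φ K := fun φ hφ ↦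
    (hcJ' φ hφ).add_right ((hcJ φ hφ).smul_right _)
  obtain ⟨β₀, hβ₀, hK2⟩ : ∃ β₀ : ℝ, β₀ ≠ 0 ∧ K * K = -(β₀ ^ 2) • 1 := by
    obtain ⟨s, t, ht, h1⟩ := hquad K (fun c hc ↦ by
      have := hindJ (-c) (n / 2) 1 (by
        rw [one_smul, add_assoc, add_comm ((n / 2) • J), ← hK, hc]; module)
      exact one_ne_zero this.2.2) hcK
    have h2 : K * K = (-1 + n ^ 2 / 4) • (1 : Module.End ℝ V) := by
      have h3 : K * K = J' * J' + (n / 2) • (J * J' + J' * J) + (n ^ 2 / 4) • (J * J) := by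
        rw [hK]
        simp only [add_mul, mul_add, smul_mul_assoc, mul_smul_comm]
        module
      rw [h3, hn, hJ2, hJ2']
      module
    have h4 : (K - s • 1) * (K - s • 1) = K * K - (2 * s) • K + (s ^ 2) • 1 := by
      simp only [sub_mul, mul_sub, smul_mul_assoc, mul_smul_comm, one_mul, mul_one]
      module
    rw [h4] at h1
    obtain ⟨-, -, h5⟩ := hindJ (-1 + n ^ 2 / 4 + s ^ 2 + t ^ 2) (-(2 * s) * (n / 2)) (-(2 * s))
      (by
        have h6 := sub_eq_zero.mpr h1
        rw [h2, hK] at h6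
        rw [← h6]
        module)
    have h6 : s = 0 := by linarith
    refine ⟨t, ht, ?_⟩
    rw [h6] at h1
    rw [← h1]
    module
  have hJs : ∀ u, J (J u) = -u := fun u ↦ LinearMap.congr_fun hJ2 u
  have hKs : ∀ u, K (K u) = -(β₀ ^ 2) • u := fun u ↦ LinearMap.congr_fun hK2 u
  have hKJ : ∀ u, K (J u) = -J (K u) := fun u ↦ LinearMap.congr_fun hanti u
  have h : IsSelfAdjointComplex b₁ J := ⟨hdim, hs₁, hb, hJs, hsJ⟩
  obtain ⟨D, hD, hD2⟩ := exists_isComplexSkew_root h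
  refine hno (hD.hasInvariantSubspace h hD2 hcJ fun φ hφ ↦ ?_)
  have hφJ := hcJ φ hφ
  have hφK := hcK φ hφ
  obtain ⟨e, rfl, he, -, -⟩ := hΦ φ hφ
  have heJ : ∀ u, e (J u) = J (e u) := fun u ↦ LinearMap.congr_fun hφJ.eq u
  have heK : ∀ u, e (K u) = K (e u) := fun u ↦ LinearMap.congr_fun hφK.eq u
  have heJ' : ∀ u, e.symm (J u) = J (e.symm u) := fun u ↦ by
    rw [LinearEquiv.symm_apply_eq, heJ, e.apply_symm_apply]
  have he1 : ∀ u v, b₁ (e u) v = b₁ u (e.symm v) := fun u v ↦ by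
    rw [← he u, e.apply_symm_apply]
  have he2 : ∀ u v, b₁ (e.symm u) v = b₁ u (e v) := fun u v ↦ by
    rw [← he (e.symm u), e.apply_symm_apply]
  have hD' : IsComplexSkew b₁ J (e.toLinearMap ∘ₗ D ∘ₗ e.symm.toLinearMap) := by
    refine ⟨fun u ↦ ?_, fun u v ↦ ?_⟩
    · simp [heJ', hD.comm, heJ]
    · simp [he1, hD.skew, he2]
  rcases hD.eq_or_eq_neg h hD' hD2 (fun u ↦ by simp [hD2]) with h1 | h1
  · refine LinearMap.ext fun u ↦ ?_
    have h2 := LinearMap.congr_fun h1 (e u)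
    simpa using h2
  exfalso
  have hanti1 : ∀ u, e (D u) = -D (e u) := fun u ↦ by
    have h2 := LinearMap.congr_fun h1 (e u)
    simpa using h2
  have hanti2 : ∀ u, e.symm (D u) = -D (e.symm u) := fun u ↦ by
    rw [LinearEquiv.symm_apply_eq, map_neg, hanti1, e.apply_symm_apply, neg_neg]
  have hD0 : ¬ ∀ u, D u = 0 := fun h0 ↦ by
    obtain ⟨x, hx⟩ := exists_ne (0 : V)
    have := hD2 x
    rw [h0, zero_eq_neg] at this
    exact hx this
  have hneg : ∀ {w : V}, w = -w → w = 0 := fun {w} hw ↦ by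
    have h2 : (2 : ℝ) • w = 0 := by rw [two_smul]; exact add_eq_zero_iff_eq_neg.mpr hw
    exact (smul_eq_zero.mp h2).resolve_left two_ne_zero
  have hT : IsComplexSkew b₁ J (e.toLinearMap - e.symm.toLinearMap) := by
    refine ⟨fun u ↦ by simp [heJ, heJ'], fun u v ↦ ?_⟩
    simp [he1, he2]
  have hinv : ∀ u, e u = e.symm u := fun u ↦ by
    have h2 := LinearMap.congr_fun (hD.commute h hT).eq u
    simp only [Module.End.mul_apply, LinearMap.sub_apply, LinearEquiv.coe_coe, hanti1, hanti2,
      map_sub] at h2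
    have h3 : (2 : ℝ) • D (e u - e.symm u) = 0 := by
      rw [← sub_eq_zero.mpr h2, map_sub]
      module
    have h4 : D (e u - e.symm u) = 0 := (smul_eq_zero.mp h3).resolve_left two_ne_zero
    refine sub_eq_zero.mp (hD.injective h (fun h0 ↦ hD0 fun u ↦ by rw [h0]; rfl) h4)
  by_cases hfix : ∃ x, x ≠ 0 ∧ e x = x
  · obtain ⟨x, hx, hex⟩ := hfix
    have hnot : ∀ p q : ℝ, K x ≠ p • x + q • J x := fun p q hpq ↦ by
      have h2 := hKs x
      rw [hpq, map_add, map_smul, map_smul, hKJ, hpq, map_add, map_smul, map_smul, hJs] at h2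
      have h3 : (p ^ 2 + q ^ 2 + β₀ ^ 2) • x = 0 := by
        rw [← sub_eq_zero.mpr h2]
        module
      have h4 := (smul_eq_zero.mp h3).resolve_right hx
      have : 0 < β₀ ^ 2 := by positivity
      nlinarith [sq_nonneg p, sq_nonneg q]
    have hid : ∀ w, e w = w := fun w ↦ by
      obtain ⟨p, q, r, s, rfl⟩ := h.exists_eq_combination hx hnot w
      simp [heJ, heK, hex]
    exact hD0 fun u ↦ hneg (by simpa [hid] using hanti1 u)
  · push Not at hfix
    have hid : ∀ w, e w = -w := fun w ↦ by
      by_contra hne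
      refine hfix (w + e w) (fun h0 ↦ hne (eq_neg_of_add_eq_zero_right h0)) ?_
      rw [map_add, hinv (e w), e.symm_apply_apply, add_comm]
    exact hD0 fun u ↦ by
      have h2 := hanti1 u
      rw [hid, hid, map_neg, neg_neg] at h2
      exact hneg h2.symm

end Forms

section Pairs

variable {V : Type*} [AddCommGroup V] [Module ℝ V]

/-- `D` is a square root of `-1` that is skew-adjoint for both forms. -/
structure IsCommonSkewRoot (b c : LinearMap.BilinForm ℝ V) (D : Module.End ℝ V) : Prop where
  sq : ∀ u, D (D u) = -u
  skew_left : ∀ u v, b (D u) v = -b u (D v)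
  skew_right : ∀ u v, c (D u) v = -c u (D v)

/-- `c` is `α b + β b (J ·, ·)` for a `b`-self-adjoint complex structure `J`. -/
def IsComplexPair (α β : ℝ) (b c : LinearMap.BilinForm ℝ V) : Prop :=
  ∃ J : Module.End ℝ V, IsSelfAdjointComplex b J ∧ ∀ u v, c u v = α * b u v + β * b (J u) v

variable {α β : ℝ} {b c : LinearMap.BilinForm ℝ V} {J D D' : Module.End ℝ V}

theorem IsSelfAdjointComplex.isComplexSkew_of_root (h : IsSelfAdjointComplex b J) (hβ : β ≠ 0)
    (hJ : ∀ u v, c u v = α * b u v + β * b (J u) v) (hD : IsCommonSkewRoot b c D) :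
    IsComplexSkew b J D where
  skew := hD.skew_left
  comm u := by
    refine sub_eq_zero.mp (h.nondegenerate _ fun v ↦ ?_)
    have h1 := hD.skew_right u v
    rw [hJ, hJ, hD.skew_left] at h1
    have h2 : β * (b (J (D u)) v + b (J u) (D v)) = 0 := by linear_combination h1
    have h3 := (mul_eq_zero.mp h2).resolve_left hβ
    rw [map_sub, LinearMap.sub_apply, hD.skew_left]
    linear_combination -h3

theorem IsComplexSkew.isCommonSkewRoot
    (hJ : ∀ u v, c u v = α * b u v + β * b (J u) v) (hD : IsComplexSkew b J D)
    (hsq : ∀ u, D (D u) = -u) : IsCommonSkewRoot b c D where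
  sq := hsq
  skew_left := hD.skew
  skew_right u v := by
    rw [hJ, hJ, hD.skew, ← hD.comm, hD.skew]
    ring

theorem IsComplexPair.eq_or_eq_neg (h : IsComplexPair α β b c) (hβ : β ≠ 0)
    (hD : IsCommonSkewRoot b c D) (hD' : IsCommonSkewRoot b c D') : D' = D ∨ D' = -D := by
  obtain ⟨J, hbJ, hJ⟩ := h
  exact (hbJ.isComplexSkew_of_root hβ hJ hD).eq_or_eq_neg hbJ (hbJ.isComplexSkew_of_root hβ hJ hD')
    hD.sq hD'.sq

section Transport

variable {V' : Type*} [AddCommGroup V'] [Module ℝ V'] {b' c' : LinearMap.BilinForm ℝ V'}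

theorem IsComplexPair.map (h : IsComplexPair α β b c) (e : V ≃ₗ[ℝ] V')
    (hb : ∀ u v, b' (e u) (e v) = b u v) (hc : ∀ u v, c' (e u) (e v) = c u v) :
    IsComplexPair α β b' c' := by
  obtain ⟨J, h, hJ⟩ := h
  have hb' : ∀ u v, b' u v = b (e.symm u) (e.symm v) := fun u v ↦ by simp [← hb]
  have hc' : ∀ u v, c' u v = c (e.symm u) (e.symm v) := fun u v ↦ by simp [← hc]
  refine ⟨e.toLinearMap ∘ₗ J ∘ₗ e.symm.toLinearMap,
    ⟨by rw [← e.finrank_eq, h.finrank], fun u v ↦ by rw [hb', hb', h.symm], fun v hv ↦ ?_,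
      fun u ↦ by simp [h.sq], fun u v ↦ by simp [hb', h.adj]⟩, fun u v ↦ by simp [hb', hc', hJ]⟩
  have := h.nondegenerate (e.symm v) fun w ↦ by simpa [hb'] using hv (e w)
  simpa using this

theorem IsCommonSkewRoot.map (hD : IsCommonSkewRoot b c D) (e : V ≃ₗ[ℝ] V')
    (hb : ∀ u v, b' (e u) (e v) = b u v) (hc : ∀ u v, c' (e u) (e v) = c u v) :
    IsCommonSkewRoot b' c' (e.toLinearMap ∘ₗ D ∘ₗ e.symm.toLinearMap) := by
  have hb' : ∀ u v, b' u v = b (e.symm u) (e.symm v) := fun u v ↦ by simp [← hb]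
  have hc' : ∀ u v, c' u v = c (e.symm u) (e.symm v) := fun u v ↦ by simp [← hc]
  exact ⟨fun u ↦ by simp [hD.sq], fun u v ↦ by simp [hb', hD.skew_left],
    fun u v ↦ by simp [hc', hD.skew_right]⟩

end Transport

/-- Two independent invariant symmetric forms on a four-dimensional space, one of them
non-degenerate, either yield an invariant subspace or form a complex pair. -/
theorem hasInvariantSubspace_or_isComplexPair (hdim : Module.finrank ℝ V = 4)
    (hs : ∀ u v, b u v = b v u) (hs' : ∀ u v, c u v = c v u)
    (hb : ∀ v, (∀ w, b v w = 0) → v = 0)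
    (hli : ∀ p q : ℝ, (∀ u v, p * b u v + q * c u v = 0) → p = 0 ∧ q = 0)
    {Φ : Set (Module.End ℝ V)}
    (hΦ : ∀ φ ∈ Φ, ∃ e : V ≃ₗ[ℝ] V, φ = e ∧ (∀ u v, b (e u) (e v) = b u v) ∧
      (∀ u v, c (e u) (e v) = c u v)) :
    HasInvariantSubspace Φ ∨ ∃ α β : ℝ, β ≠ 0 ∧ IsComplexPair α β b c := by
  have : FiniteDimensional ℝ V := .of_finrank_pos (by rw [hdim]; norm_num)
  have : Nontrivial V := Module.nontrivial_of_finrank_pos (R := ℝ) (by rw [hdim]; norm_num)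
  obtain ⟨A, hA⟩ := exists_operator hb c
  have hcA : ∀ φ ∈ Φ, Commute φ A := fun φ hφ ↦ by
    obtain ⟨e, rfl, h1, h2⟩ := hΦ φ hφ
    exact LinearMap.ext (intertwine_operator hb hA hA e h1 h2)
  have hsA : ∀ u v, b (A u) v = b u (A v) := fun u v ↦ by rw [hA, hs u, hA, hs']
  refine (hasInvariantSubspace_or_sq_eq A (fun r hr ↦ ?_) hcA).imp_right ?_
  · refine one_ne_zero (hli (-r) 1 fun u v ↦ ?_).2
    rw [← hA, hr]
    simp
  · rintro ⟨α, β, hβ, h⟩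
    refine ⟨α, β, hβ, β⁻¹ • (A - α • 1), ⟨hdim, hs, hb, fun u ↦ ?_, fun u v ↦ ?_⟩, fun u v ↦ ?_⟩
    · have h1 := LinearMap.congr_fun h u
      simp only [Module.End.mul_apply] at h1
      rw [LinearMap.smul_apply, LinearMap.smul_apply, map_smul, h1, LinearMap.smul_apply,
        smul_smul, smul_smul, Module.End.one_apply, ← neg_one_smul ℝ u]
      congr 1
      field_simp
    · simp [hsA]
    · simp only [LinearMap.smul_apply, LinearMap.sub_apply, Module.End.one_apply, map_smul,
        map_sub, smul_eq_mul, hA]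
      field_simp
      ring

/-- Isometries of a complex pair preserving a common skew root have an invariant subspace. -/
theorem IsComplexPair.hasInvariantSubspace (h : IsComplexPair α β b c) (hβ : β ≠ 0)
    (hD : IsCommonSkewRoot b c D) {Φ : Set (Module.End ℝ V)}
    (hΦ : ∀ φ ∈ Φ, ∃ e : V ≃ₗ[ℝ] V, φ = e ∧ (∀ u v, b (e u) (e v) = b u v) ∧
      (∀ u v, c (e u) (e v) = c u v))
    (hcD : ∀ φ ∈ Φ, Commute φ D) : HasInvariantSubspace Φ := by
  obtain ⟨J, hbJ, hJ⟩ := h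
  have hA : ∀ u v, b (β • J u) v = (c - α • b) u v := fun u v ↦ by simp [hJ]
  refine (hbJ.isComplexSkew_of_root hβ hJ hD).hasInvariantSubspace hbJ hD.sq (fun φ hφ ↦ ?_) hcD
  obtain ⟨e, rfl, h1, h2⟩ := hΦ φ hφ
  refine LinearMap.ext fun u ↦ ?_
  have h3 := intertwine_operator (A := β • J) (A' := β • J) hbJ.nondegenerate hA hA e h1
    (fun u v ↦ by simp [h1, h2]) u
  simp only [LinearMap.smul_apply, map_smul] at h3
  exact smul_right_injective V hβ h3

end Pairs

section Continuity

variable {E : Type*} [NormedAddCommGroup E] [NormedSpace ℝ E] [FiniteDimensional ℝ E]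

/-- A non-degenerate form as an isomorphism with the dual. -/
theorem exists_continuousLinearEquiv_of_nondegenerate (G : E →L[ℝ] E →L[ℝ] ℝ)
    (hG : ∀ v, (∀ w, G v w = 0) → v = 0) :
    ∃ e : E ≃L[ℝ] (E →L[ℝ] ℝ), (e : E →L[ℝ] E →L[ℝ] ℝ) = G := by
  have hinj : Function.Injective G.toLinearMap := by
    rw [injective_iff_map_eq_zero]
    exact fun v hv ↦ hG v fun w ↦ by
      have h1 : G v = 0 := hv
      rw [h1]; rfl
  have hdim : Module.finrank ℝ E = Module.finrank ℝ (E →L[ℝ] ℝ) := by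
    rw [← (LinearMap.toContinuousLinearMap (𝕜 := ℝ) (E := E) (F' := ℝ)).finrank_eq]
    exact (Subspace.dual_finrank_eq (K := ℝ) (V := E)).symm
  exact ⟨(LinearMap.linearEquivOfInjective G.toLinearMap hinj hdim).toContinuousLinearEquiv,
    ContinuousLinearMap.ext fun v ↦ rfl⟩

/-- The complex structure of a complex pair, as a function of the two forms. -/
noncomputable def pairComplexStructure (α β : ℝ) (G₁ G₂ : E →L[ℝ] E →L[ℝ] ℝ) : E →L[ℝ] E :=
  β⁻¹ • ((ContinuousLinearMap.inverse G₁).comp G₂ - α • ContinuousLinearMap.id ℝ E)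

theorem IsComplexPair.pairComplexStructure_eq {α β : ℝ} {G₁ G₂ : E →L[ℝ] E →L[ℝ] ℝ} (hβ : β ≠ 0)
    (h : IsComplexPair α β G₁.toBilinForm G₂.toBilinForm) :
    IsSelfAdjointComplex G₁.toBilinForm (pairComplexStructure α β G₁ G₂).toLinearMap ∧
    ∀ u v, G₂ u v = α * G₁ u v + β * G₁ (pairComplexStructure α β G₁ G₂ u) v := by
  obtain ⟨J, hbJ, hJ⟩ := h
  have hnd : ∀ v, (∀ w, G₁ v w = 0) → v = 0 := hbJ.nondegenerate
  obtain ⟨e, he⟩ := exists_continuousLinearEquiv_of_nondegenerate G₁ hnd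
  have h1 : ∀ u v, G₂ u v = α * G₁ u v + β * G₁ (pairComplexStructure α β G₁ G₂ u) v := by
    intro u v
    have h2 : G₁ (ContinuousLinearMap.inverse G₁ (G₂ u)) = G₂ u := by
      rw [← he, ContinuousLinearMap.inverse_equiv]
      exact e.apply_symm_apply _
    simp only [pairComplexStructure, smul_apply, sub_apply, ContinuousLinearMap.comp_apply,
      ContinuousLinearMap.id_apply, map_smul, map_sub, h2,
      smul_eq_mul]
    field_simp
    ring
  have h3 : (pairComplexStructure α β G₁ G₂).toLinearMap = J := by
    ext u
    refine sub_eq_zero.mp (hnd _ fun v ↦ ?_)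
    have h4 : G₂ u v = α * G₁ u v + β * G₁ (J u) v := hJ u v
    rw [h1 u v] at h4
    have h5 : β * (G₁ (pairComplexStructure α β G₁ G₂ u) v - G₁ (J u) v) = 0 := by
      linear_combination h4
    have h6 := (mul_eq_zero.mp h5).resolve_left hβ
    rw [map_sub]
    exact h6
  exact ⟨h3 ▸ hbJ, h1⟩

/-- A continuous family of complex pairs has a continuous family of common skew roots locally. -/
theorem exists_continuousAt_isCommonSkewRoot {X : Type*} [TopologicalSpace X] {x₀ : X} {α β : ℝ}
    (hβ : β ≠ 0) {G₁ G₂ : X → E →L[ℝ] E →L[ℝ] ℝ} (hG₁ : ∀ᶠ x in 𝓝 x₀, ContinuousAt G₁ x)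
    (hG₂ : ∀ᶠ x in 𝓝 x₀, ContinuousAt G₂ x)
    (h : ∀ᶠ x in 𝓝 x₀, IsComplexPair α β (G₁ x).toBilinForm (G₂ x).toBilinForm) :
    ∃ D : X → E →L[ℝ] E, ∀ᶠ x in 𝓝 x₀, ContinuousAt D x ∧
      IsCommonSkewRoot (G₁ x).toBilinForm (G₂ x).toBilinForm (D x).toLinearMap := by
  set J : X → E →L[ℝ] E := fun x ↦ pairComplexStructure α β (G₁ x) (G₂ x) with hJdef
  have hJ : ∀ᶠ x in 𝓝 x₀, ContinuousAt J x := by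
    filter_upwards [hG₁, hG₂, h] with x h1 h2 h'
    obtain ⟨J', h3, -⟩ := h'
    obtain ⟨e, he⟩ := exists_continuousLinearEquiv_of_nondegenerate (G₁ x) h3.nondegenerate
    have h4 : ContinuousAt (ContinuousLinearMap.inverse : (E →L[ℝ] E →L[ℝ] ℝ) → _) (G₁ x) := by
      rw [← he]
      exact (contDiffAt_map_inverse (n := 0) e).continuousAt
    have h5 : ContinuousAt (fun x ↦ ContinuousLinearMap.inverse (G₁ x)) x :=
      ContinuousAt.comp (g := ContinuousLinearMap.inverse) h4 h1
    have h6 : ContinuousAt (fun x ↦ (ContinuousLinearMap.inverse (G₁ x)).comp (G₂ x) -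
        α • ContinuousLinearMap.id ℝ E) x := (h5.clm_comp h2).sub continuousAt_const
    exact h6.const_smul β⁻¹
  have hpair := fun x (hx : IsComplexPair α β (G₁ x).toBilinForm (G₂ x).toBilinForm) ↦
    hx.pairComplexStructure_eq hβ
  obtain ⟨u, v, hu, hz⟩ := exists_complexGram_ne_zero (hpair x₀ h.self_of_nhds).1
  obtain ⟨w, hw⟩ := exists_continuousAt_sq_mul_eq hz
  let z : X → ℂ := fun x ↦ complexGram (G₁ x).toBilinForm (J x).toLinearMap u v
  have hzc : ∀ᶠ x in 𝓝 x₀, ContinuousAt z x := by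
    filter_upwards [hG₁, hJ] with x h1 h2
    have key : ∀ (a b : X → E), ContinuousAt a x → ContinuousAt b x →
        ContinuousAt (fun y ↦ G₁ y (a y) (b y)) x := fun a b ha hb ↦ (h1.clm_apply ha).clm_apply hb
    have hcu := continuousAt_const (x := x) (y := u)
    have hcv := continuousAt_const (x := x) (y := v)
    have hJu := h2.clm_apply hcu
    have hJv := h2.clm_apply hcv
    have hre : ContinuousAt (fun y ↦ (z y).re) x :=
      ((((key _ _ hcu hcv).pow 2).sub ((key _ _ hcu hJv).pow 2)).sub
        ((key _ _ hcu hcu).mul (key _ _ hcv hcv))).add ((key _ _ hcu hJu).mul (key _ _ hcv hJv))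
    have him : ContinuousAt (fun y ↦ (z y).im) x :=
      (((continuousAt_const.mul (key _ _ hcu hcv)).mul (key _ _ hcu hJv)).add
        ((key _ _ hcu hcu).mul (key _ _ hcv hJv))).add ((key _ _ hcu hJu).mul (key _ _ hcv hcv))
    have heq : z = fun y ↦ ((z y).re : ℂ) + (z y).im * Complex.I := by
      funext y
      exact (Complex.re_add_im (z y)).symm
    rw [heq]
    exact (Complex.continuous_ofReal.continuousAt.comp hre).add
      ((Complex.continuous_ofReal.continuousAt.comp him).mul continuousAt_const)
  let R : X → E →L[ℝ] E := fun x ↦ (G₁ x u).smulRight v -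
    ((G₁ x u).comp (J x)).smulRight (J x v) - (G₁ x v).smulRight u +
      ((G₁ x v).comp (J x)).smulRight (J x u)
  have hR : ∀ᶠ x in 𝓝 x₀, ContinuousAt R x := by
    filter_upwards [hG₁, hJ] with x h1 h2
    have key : ∀ (l : X → E →L[ℝ] ℝ) (a : X → E), ContinuousAt l x → ContinuousAt a x →
        ContinuousAt (fun y ↦ (l y).smulRight (a y)) x := fun l a hl ha ↦
      (((ContinuousLinearMap.smulRightL ℝ E E).continuous.continuousAt.comp hl).clm_apply ha)
    have hcu := continuousAt_const (x := x) (y := u)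
    have hcv := continuousAt_const (x := x) (y := v)
    have hGu := h1.clm_apply hcu
    have hGv := h1.clm_apply hcv
    exact (((key _ _ hGu hcv).sub (key _ _ (hGu.clm_comp h2) (h2.clm_apply hcv))).sub
      (key _ _ hGv hcu)).add (key _ _ (hGv.clm_comp h2) (h2.clm_apply hcu))
  refine ⟨fun x ↦ (w (z x)).re • R x + (w (z x)).im • (J x).comp (R x), ?_⟩
  have hwz := hzc.self_of_nhds.eventually hw
  filter_upwards [hR, hJ, hzc, hwz, h] with x h1 h2 h3 ⟨h4, h4'⟩ h5
  refine ⟨?_, ?_⟩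
  · have h6 : ContinuousAt (fun y ↦ w (z y)) x := ContinuousAt.comp (g := w) h4 h3
    exact ((Complex.continuous_re.continuousAt.comp h6).smul h1).add
      ((Complex.continuous_im.continuousAt.comp h6).smul (h2.clm_comp h1))
  · obtain ⟨h6, h7⟩ := hpair x h5
    obtain ⟨h8, h9⟩ := isComplexSkew_normalize h6 hu h4'
    exact h8.isCommonSkewRoot h7 h9

end Continuity

section Signs

/-- The two-sheeted fibre bundle glued from the locally constant signs `s i * s j`. -/
def signBundleCore {X : Type*} [TopologicalSpace X] (U : X → Set X) (hU : ∀ i, IsOpen (U i))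
    (hmem : ∀ i, i ∈ U i) (s : X → X → ℤˣ)
    (hs : ∀ i j, ∀ x ∈ U i ∩ U j, ∀ᶠ y in 𝓝 x, s i y * s j y = s i x * s j x) :
    FiberBundleCore X X ℤˣ where
  baseSet := U
  isOpen_baseSet := hU
  indexAt := id
  mem_baseSet_at := hmem
  coordChange i j x ε := ε * (s i x * s j x)
  coordChange_self i x _ ε := by simp [Int.units_mul_self]
  continuousOn_coordChange i j := by
    rintro ⟨x, ε⟩ ⟨hx, -⟩
    have h1 : ContinuousAt (fun y ↦ s i y * s j y) x :=
      (continuousAt_const (y := s i x * s j x)).congr (by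
        filter_upwards [hs i j x hx] with y hy using hy.symm)
    have h2 : ContinuousAt (fun p : X × ℤˣ ↦ s i p.1 * s j p.1) (x, ε) :=
      ContinuousAt.comp (f := Prod.fst) (x := (x, ε)) h1 continuousAt_fst
    exact (continuousAt_snd.mul h2).continuousWithinAt
  coordChange_comp i j k x _ ε := by
    rw [mul_assoc, mul_assoc (s i x), ← mul_assoc (s j x) (s j x), Int.units_mul_self, one_mul]

/-- On a simply connected space a sign cocycle of the form `s i * s j` is a coboundary of locally
constant signs. -/
theorem exists_sign_of_simplyConnected {X : Type*} [TopologicalSpace X] [SimplyConnectedSpace X]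
    [LocallyPathConnectedSpace X] (U : X → Set X) (hU : ∀ i, IsOpen (U i)) (hmem : ∀ i, i ∈ U i)
    (s : X → X → ℤˣ)
    (hs : ∀ i j, ∀ x ∈ U i ∩ U j, ∀ᶠ y in 𝓝 x, s i y * s j y = s i x * s j x) :
    ∃ ε : X → ℤˣ, ∀ i, ∀ᶠ y in 𝓝 i, ε y * s i y = ε i * s i i := by
  let Z := signBundleCore U hU hmem s hs
  have hcov : IsCoveringMap (Bundle.TotalSpace.proj : Bundle.TotalSpace ℤˣ Z.Fiber → X) :=
    FiberBundle.isCoveringMap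
  obtain ⟨x₀⟩ : Nonempty X := inferInstance
  obtain ⟨f, ⟨-, hf⟩, -⟩ := hcov.existsUnique_continuousMap_lifts (ContinuousMap.id X) x₀
    (⟨x₀, (1 : ℤˣ)⟩ : Bundle.TotalSpace ℤˣ Z.Fiber) rfl
  have hproj : ∀ y, (f y).1 = y := fun y ↦ congrFun hf y
  let val : Bundle.TotalSpace ℤˣ Z.Fiber → ℤˣ := fun p ↦ p.2
  refine ⟨fun y ↦ val (f y) * s y y, fun i ↦ ?_⟩
  have hcont : ContinuousAt (fun y ↦ ((Z.localTriv i) (f y)).2) i := by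
    have h1 : f i ∈ (Z.localTriv i).source := by
      rw [Z.mem_localTriv_source, hproj]
      exact hmem i
    have h2 : ContinuousAt (Z.localTriv i) (f i) :=
      (Z.localTriv i).toOpenPartialHomeomorph.continuousAt h1
    exact continuousAt_snd.comp (ContinuousAt.comp h2 f.continuous.continuousAt)
  have hval : ∀ y, ((Z.localTriv i) (f y)).2 = val (f y) * s y y * s i y := by
    intro y
    have h1 : ((Z.localTriv i) (f y)).2 = val (f y) * (s (f y).1 (f y).1 * s i (f y).1) := by
      rw [Z.localTriv_apply]
      rfl
    rw [h1, hproj, mul_assoc]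
  have h3 := hcont.eventually (isOpen_discrete {((Z.localTriv i) (f i)).2} |>.mem_nhds rfl)
  filter_upwards [h3] with y hy
  rw [← hval y, ← hval i]
  exact hy

/-- Two continuous vector-valued functions agreeing up to sign differ by a locally constant
sign. -/
theorem eventually_sign_eq {X F : Type*} [TopologicalSpace X] [NormedAddCommGroup F]
    [InnerProductSpace ℝ F] {S : Set X} {x : X} (hx : x ∈ S) {a b : X → F} {s : X → ℤˣ}
    (ha : ContinuousWithinAt a S x) (hb : ContinuousWithinAt b S x) (hbx : b x ≠ 0)
    (hab : ∀ᶠ y in 𝓝[S] x, a y = ((s y : ℤ) : ℝ) • b y) : ∀ᶠ y in 𝓝[S] x, s y = s x := by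
  have h1 : ContinuousWithinAt (fun y ↦ inner ℝ (a y) (((s x : ℤ) : ℝ) • b y)) S x :=
    ha.inner (𝕜 := ℝ) (continuousWithinAt_const.smul hb)
  have h2 : 0 < inner ℝ (a x) (((s x : ℤ) : ℝ) • b x) := by
    rw [hab.self_of_nhdsWithin hx, real_inner_self_eq_norm_sq]
    have : ((s x : ℤ) : ℝ) • b x ≠ 0 := by
      refine smul_ne_zero ?_ hbx
      exact_mod_cast (s x).ne_zero
    positivity
  filter_upwards [h1.eventually (isOpen_Ioi.mem_nhds h2), hab] with y hy hy'
  by_contra hne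
  have h3 : ((s y : ℤ) : ℝ) = -((s x : ℤ) : ℝ) := by
    rcases Int.units_eq_one_or (s y) with h | h <;> rcases Int.units_eq_one_or (s x) with h' | h' <;>
      simp_all
  rw [hy', h3, neg_smul, inner_neg_left, real_inner_self_eq_norm_sq] at hy
  have : (0 : ℝ) < -‖((s x : ℤ) : ℝ) • b y‖ ^ 2 := hy
  nlinarith [sq_nonneg ‖((s x : ℤ) : ℝ) • b y‖]

end Signs

section LinearODE

variable {E : Type*} [NormedAddCommGroup E] [NormedSpace ℝ E]

theorem exists_hasDerivWithinAt_linear [CompleteSpace E] {A : ℝ → E →L[ℝ] E}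
    (hA : ContinuousOn A (Icc 0 1)) (hbound : ∀ t ∈ Icc (0 : ℝ) 1, ‖A t‖ ≤ 1 / 2) (u : E) :
    ∃ y : ℝ → E, y 0 = u ∧ ∀ t ∈ Icc (0 : ℝ) 1, HasDerivWithinAt y (A t (y t)) (Icc 0 1) t := by
  have h : IsPicardLindelof (fun t x ↦ A t x) (⟨0, by simp⟩ : Icc (0 : ℝ) 1) u ‖u‖₊ 0 ‖u‖₊
      (1 / 2) := by
    refine ⟨fun t ht ↦ ?_, fun x _ ↦ hA.clm_apply continuousOn_const, fun t ht x hx ↦ ?_, ?_⟩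
    · exact ((A t).lipschitz.weaken (by exact_mod_cast hbound t ht)).lipschitzOnWith
    · have h1 : ‖x‖ ≤ 2 * ‖u‖ := by
        have h2 := norm_le_norm_add_norm_sub' x u
        rw [mem_closedBall_iff_norm] at hx
        have h3 : ‖x - u‖ ≤ ‖u‖ := hx
        linarith
      calc ‖A t x‖ ≤ ‖A t‖ * ‖x‖ := (A t).le_opNorm x
        _ ≤ 1 / 2 * (2 * ‖u‖) := by gcongr; exact hbound t ht
        _ = ‖u‖₊ := by simp
    · simp
  exact h.exists_eq_forall_mem_Icc_hasDerivWithinAt₀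

theorem hasDerivWithinAt_clm_of_apply [FiniteDimensional ℝ E] {F : Type*} [NormedAddCommGroup F]
    [NormedSpace ℝ F] {L : ℝ → E →L[ℝ] F} {L' : E →L[ℝ] F} {s : Set ℝ} {t : ℝ}
    (h : ∀ u, HasDerivWithinAt (fun τ ↦ L τ u) (L' u) s t) : HasDerivWithinAt L L' s t := by
  let b := Module.finBasis ℝ E
  have key : ∀ T : E →L[ℝ] F, T = ∑ i, ContinuousLinearMap.smulRightL ℝ E F
      (LinearMap.toContinuousLinearMap (b.coord i)) (T (b i)) := fun T ↦ by
    refine ContinuousLinearMap.ext fun x ↦ ?_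
    conv_lhs => rw [← b.sum_repr x, map_sum]
    simp
  rw [key L', funext fun τ ↦ key (L τ)]
  refine HasDerivWithinAt.fun_sum fun i _ ↦ ?_
  exact (ContinuousLinearMap.hasFDerivAt _).comp_hasDerivWithinAt t (h (b i))

theorem continuousAt_clm_of_apply [FiniteDimensional ℝ E] {F X : Type*} [NormedAddCommGroup F]
    [NormedSpace ℝ F] [TopologicalSpace X] {L : X → E →L[ℝ] F} {x : X}
    (h : ∀ u, ContinuousAt (fun y ↦ L y u) x) : ContinuousAt L x := by
  rw [← continuousWithinAt_univ]
  exact continuousWithinAt_clm_apply.mpr fun u ↦ (h u).continuousWithinAt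

end LinearODE

noncomputable section

section Coordinates

variable {E : Type*} [NormedAddCommGroup E] [NormedSpace ℝ E]
  {H : Type*} [TopologicalSpace H] {I : ModelWithCorners ℝ E H}
  {M : Type*} [TopologicalSpace M] [ChartedSpace H M] [IsManifold I ∞ M]

variable (I) in
/-- The trivialization of the tangent bundle given by the chart at `x₀`. -/
abbrev tangentTriv (x₀ : M) : Trivialization E (Bundle.TotalSpace.proj :
    TangentBundle I M → M) :=
  trivializationAt E (TangentSpace I : M → Type _) x₀

/-- The coordinates of a tangent vector in the chart at `x₀`. -/
def tangentCoord (x₀ : M) {y : M} (v : TangentSpace I y) : E :=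
  (tangentTriv I x₀ (TotalSpace.mk' E y v)).2

variable (I) in
/-- The vector field with constant coordinates `u` in the chart at `x₀`. -/
def constField (x₀ : M) (u : E) (y : M) : TangentSpace I y :=
  (tangentTriv I x₀).symm y u

variable {x₀ y : M}

theorem mem_baseSet_tangentTriv (x : M) : x ∈ (tangentTriv I x).baseSet :=
  FiberBundle.mem_baseSet_trivializationAt' x

theorem tangentCoord_constField (hy : y ∈ (tangentTriv I x₀).baseSet) (u : E) :
    tangentCoord x₀ (constField I x₀ u y) = u := by
  simp only [tangentCoord, constField]
  exact congrArg Prod.snd ((tangentTriv I x₀).apply_mk_symm hy u)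

theorem constField_tangentCoord (hy : y ∈ (tangentTriv I x₀).baseSet) (v : TangentSpace I y) :
    constField I x₀ (tangentCoord x₀ v) y = v :=
  (tangentTriv I x₀).symm_apply_apply_mk hy v

theorem tangentCoord_eq_continuousLinearEquivAt (hy : y ∈ (tangentTriv I x₀).baseSet)
    (v : TangentSpace I y) :
    tangentCoord x₀ v = (tangentTriv I x₀).continuousLinearEquivAt ℝ y hy v := rfl

theorem constField_eq_symm_continuousLinearEquivAt (hy : y ∈ (tangentTriv I x₀).baseSet) (u : E) :
    constField I x₀ u y = ((tangentTriv I x₀).continuousLinearEquivAt ℝ y hy).symm u := by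
  rw [ContinuousLinearEquiv.eq_symm_apply]
  exact tangentCoord_constField hy u

theorem contMDiffOn_constField (x₀ : M) (u : E) :
    CMDiff[(tangentTriv I x₀).baseSet] ∞ (T% (constField I x₀ u)) := by
  rw [(tangentTriv I x₀).contMDiffOn_section_baseSet_iff]
  exact contMDiffOn_const.congr fun y hy ↦ tangentCoord_constField hy u

theorem contMDiffAt_constField (hy : y ∈ (tangentTriv I x₀).baseSet) (u : E) :
    CMDiffAt ∞ (T% (constField I x₀ u)) y :=
  (contMDiffOn_constField x₀ u).contMDiffAt ((tangentTriv I x₀).open_baseSet.mem_nhds hy)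

theorem mdiffAt_constField (hy : y ∈ (tangentTriv I x₀).baseSet) (u : E) :
    MDiffAt (T% (constField I x₀ u)) y :=
  (contMDiffAt_constField hy u).mdifferentiableAt (by simp)

/-- The coordinates of a semi-Riemannian metric in the chart at `x₀`. -/
def SemiRiemannianMetric.coord (g : SemiRiemannianMetric I M) (x₀ y : M) : E →L[ℝ] E →L[ℝ] ℝ :=
  ((tangentTriv I x₀).symmL ℝ y).precomp ℝ ∘L g.form y ∘L (tangentTriv I x₀).symmL ℝ y

theorem SemiRiemannianMetric.coord_apply (g : SemiRiemannianMetric I M)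
    (hy : y ∈ (tangentTriv I x₀).baseSet) (u v : E) :
    g.coord x₀ y u v = g.form y (constField I x₀ u y) (constField I x₀ v y) := by
  have h (w : E) : (tangentTriv I x₀).symmL ℝ y w = constField I x₀ w y :=
    (tangentTriv I x₀).symmL_apply hy w
  rw [← h, ← h]
  rfl

theorem SemiRiemannianMetric.contMDiffAt_form_constField (g : SemiRiemannianMetric I M)
    (hy : y ∈ (tangentTriv I x₀).baseSet) (u v : E) :
    CMDiffAt ∞ (fun y ↦ g.form y (constField I x₀ u y) (constField I x₀ v y)) y := by
  have h : ContMDiffAt I (I.prod 𝓘(ℝ)) ∞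
      (fun m ↦ TotalSpace.mk' ℝ (E := Bundle.Trivial M ℝ) m
        (g.form m (constField I x₀ u m) (constField I x₀ v m))) y := by
    apply ContMDiffAt.clm_bundle_apply₂ (F₁ := E) (F₂ := E)
    · exact g.smooth.contMDiffAt
    · exact contMDiffAt_constField hy u
    · exact contMDiffAt_constField hy v
  simp only [contMDiffAt_totalSpace] at h
  exact h.2

theorem SemiRiemannianMetric.continuousAt_coord [FiniteDimensional ℝ E]
    (g : SemiRiemannianMetric I M)
    (hy : y ∈ (tangentTriv I x₀).baseSet) : ContinuousAt (g.coord x₀) y := by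
  refine continuousAt_clm_of_apply fun u ↦ continuousAt_clm_of_apply fun v ↦ ?_
  refine (g.contMDiffAt_form_constField hy u v).continuousAt.congr ?_
  filter_upwards [(tangentTriv I x₀).open_baseSet.mem_nhds hy] with z hz
  exact (g.coord_apply hz u v).symm

/-- The derivative of the coordinates of a parallel metric. -/
theorem SemiRiemannianMetric.IsParallel.mvfderiv_coord {g : SemiRiemannianMetric I M}
    {cov : CovariantDerivative I E (TangentSpace I : M → Type _)} (hg : g.IsParallel cov)
    (hy : y ∈ (tangentTriv I x₀).baseSet) (u v : E) (X : TangentSpace I y) :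
    mvfderiv I (fun y ↦ g.form y (constField I x₀ u y) (constField I x₀ v y)) y X =
      g.coord x₀ y (tangentCoord x₀ (cov (constField I x₀ u) y X)) v +
      g.coord x₀ y u (tangentCoord x₀ (cov (constField I x₀ v) y X)) := by
  rw [hg y X _ _ (mdiffAt_constField hy u) (mdiffAt_constField hy v), g.coord_apply hy,
    g.coord_apply hy, constField_tangentCoord hy, constField_tangentCoord hy]

end Coordinates

section Christoffel

variable {E : Type*} [NormedAddCommGroup E] [NormedSpace ℝ E]
  {H : Type*} [TopologicalSpace H] {I : ModelWithCorners ℝ E H}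
  {M : Type*} [TopologicalSpace M] [ChartedSpace H M] [IsManifold I ∞ M]
  {x₀ y : M}

theorem constField_add (hy : y ∈ (tangentTriv I x₀).baseSet) (u v : E) :
    constField I x₀ (u + v) y = constField I x₀ u y + constField I x₀ v y := by
  simp only [constField_eq_symm_continuousLinearEquivAt hy, map_add]

theorem constField_smul (hy : y ∈ (tangentTriv I x₀).baseSet) (r : ℝ) (u : E) :
    constField I x₀ (r • u) y = r • constField I x₀ u y := by
  simp only [constField_eq_symm_continuousLinearEquivAt hy, map_smul]

theorem cov_constField_add (cov : CovariantDerivative I E (TangentSpace I : M → Type _))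
    (hy : y ∈ (tangentTriv I x₀).baseSet) (u v : E) :
    cov (constField I x₀ (u + v)) y = cov (constField I x₀ u) y + cov (constField I x₀ v) y := by
  have hadd := mdifferentiableAt_add_section (mdiffAt_constField hy u) (mdiffAt_constField hy v)
  rw [← cov.isCovariantDerivativeOnUniv.add (mdiffAt_constField hy u) (mdiffAt_constField hy v)]
  refine cov.isCovariantDerivativeOnUniv.congr_of_eventuallyEq (mdiffAt_constField hy _) hadd
    Filter.univ_mem ?_
  filter_upwards [(tangentTriv I x₀).open_baseSet.mem_nhds hy] with z hz using
    constField_add hz u v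

theorem cov_constField_smul (cov : CovariantDerivative I E (TangentSpace I : M → Type _))
    (hy : y ∈ (tangentTriv I x₀).baseSet) (r : ℝ) (u : E) :
    cov (constField I x₀ (r • u)) y = r • cov (constField I x₀ u) y := by
  have hsmul := (mdiffAt_constField hy u).smul_const_section (a := r)
  rw [← cov.isCovariantDerivativeOnUniv.smul_const r (mdiffAt_constField hy u)]
  refine cov.isCovariantDerivativeOnUniv.congr_of_eventuallyEq (mdiffAt_constField hy _) hsmul
    Filter.univ_mem ?_
  filter_upwards [(tangentTriv I x₀).open_baseSet.mem_nhds hy] with z hz using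
    constField_smul hz r u

variable [FiniteDimensional ℝ E]

open Classical in
/-- The Christoffel symbols of a linear connection in the chart at `x₀`. -/
def christoffel (cov : CovariantDerivative I E (TangentSpace I : M → Type _)) (x₀ y : M) :
    E →L[ℝ] E →L[ℝ] E :=
  if hy : y ∈ (tangentTriv I x₀).baseSet then
    let e := (tangentTriv I x₀).continuousLinearEquivAt ℝ y hy
    LinearMap.toContinuousLinearMap
      { toFun := fun w ↦ LinearMap.toContinuousLinearMap
          { toFun := fun u ↦ e (cov (constField I x₀ u) y (e.symm w))
            map_add' := fun u v ↦ by rw [cov_constField_add cov hy, add_apply, map_add]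
            map_smul' := fun r u ↦ by
              rw [cov_constField_smul cov hy, smul_apply, map_smul, RingHom.id_apply] }
        map_add' := fun w w' ↦ by
          ext u
          simp
        map_smul' := fun r w ↦ by
          ext u
          simp }
  else 0

theorem christoffel_apply (cov : CovariantDerivative I E (TangentSpace I : M → Type _))
    (hy : y ∈ (tangentTriv I x₀).baseSet) (w u : E) :
    christoffel cov x₀ y w u =
      tangentCoord x₀ (cov (constField I x₀ u) y (constField I x₀ w y)) := by
  rw [christoffel, dif_pos hy, constField_eq_symm_continuousLinearEquivAt hy,
    tangentCoord_eq_continuousLinearEquivAt hy]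
  rfl

theorem christoffel_tangentCoord (cov : CovariantDerivative I E (TangentSpace I : M → Type _))
    (hy : y ∈ (tangentTriv I x₀).baseSet) (X : TangentSpace I y) (u : E) :
    christoffel cov x₀ y (tangentCoord x₀ X) u = tangentCoord x₀ (cov (constField I x₀ u) y X) := by
  rw [christoffel_apply cov hy, constField_tangentCoord hy]

theorem eventually_continuousAt_christoffel [T2Space M]
    (cov : CovariantDerivative I E (TangentSpace I : M → Type _))
    (hcov : CovariantDerivative.ContMDiffCovariantDerivative cov ∞) (x₀ : M) :
    ∀ᶠ y in 𝓝 x₀, ContinuousAt (christoffel cov x₀) y := by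
  obtain ⟨f⟩ : Nonempty (SmoothBumpFunction I x₀) := inferInstance
  have hx₀ : x₀ ∈ (tangentTriv I x₀).baseSet := FiberBundle.mem_baseSet_trivializationAt' x₀
  have hbase := (tangentTriv I x₀).open_baseSet.mem_nhds hx₀
  filter_upwards [f.eventuallyEq_one.eventuallyEq_nhds, hbase] with y hfy hy
  refine continuousAt_clm_of_apply fun w ↦ continuousAt_clm_of_apply fun u ↦ ?_
  have hsmooth : ContMDiff I (I.prod 𝓘(ℝ, E)) ∞ (T% ((f : M → ℝ) • constField I x₀ u)) :=
    ContMDiffOn.smul_section_of_tsupport f.contMDiff.contMDiffOn (tangentTriv I x₀).open_baseSet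
      f.tsupport_subset_chartAt_source (contMDiffOn_constField x₀ u)
  have hsec := hcov.contMDiff.contMDiff (σ := (f : M → ℝ) • constField I x₀ u)
    hsmooth.contMDiffOn
  have hsec' := (hsec.contMDiffAt (x := y) Filter.univ_mem).clm_bundle_apply
    (contMDiffAt_constField hy w)
  have hcont := (((tangentTriv I x₀).contMDiffAt_section_iff hy).mp hsec').continuousAt
  refine hcont.congr ?_
  filter_upwards [hfy.eventuallyEq_nhds, (tangentTriv I x₀).open_baseSet.mem_nhds hy] with z hz hzb
  rw [christoffel_apply cov hzb]
  have h1 : cov ((f : M → ℝ) • constField I x₀ u) z = cov (constField I x₀ u) z := by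
    refine cov.isCovariantDerivativeOnUniv.congr_of_eventuallyEq
      (hsmooth.contMDiffAt.mdifferentiableAt (by simp)) (mdiffAt_constField hzb u)
      Filter.univ_mem ?_
    filter_upwards [hz] with z' hz'
    simp [hz']
  rw [h1]
  rfl

end Christoffel

section AlongCurve

variable {E : Type*} [NormedAddCommGroup E] [NormedSpace ℝ E] [FiniteDimensional ℝ E]
  {H : Type*} [TopologicalSpace H] {I : ModelWithCorners ℝ E H}
  {M : Type*} [TopologicalSpace M] [ChartedSpace H M] [IsManifold I ∞ M]

/-- A parallel metric is constant to first order on fields along a curve that are parallel to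
first order. -/
theorem SemiRiemannianMetric.IsParallel.hasDerivWithinAt_coord {g : SemiRiemannianMetric I M}
    {cov : CovariantDerivative I E (TangentSpace I : M → Type _)} (hg : g.IsParallel cov)
    {x₀ : M} {c : ℝ → M} {s : Set ℝ} {t : ℝ} (hct : c t ∈ (tangentTriv I x₀).baseSet)
    {c' : TangentSpace 𝓘(ℝ, ℝ) t →L[ℝ] TangentSpace I (c t)}
    (hc : HasMFDerivWithinAt 𝓘(ℝ, ℝ) I c s t c') {y z : ℝ → E}
    (hy : HasDerivWithinAt y
      (-christoffel cov x₀ (c t) (tangentCoord x₀ (c' (1 : ℝ))) (y t)) s t)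
    (hz : HasDerivWithinAt z
      (-christoffel cov x₀ (c t) (tangentCoord x₀ (c' (1 : ℝ))) (z t)) s t) :
    HasDerivWithinAt (fun τ ↦ g.coord x₀ (c τ) (y τ) (z τ)) 0 s t := by
  set Γ := christoffel cov x₀ (c t) (tangentCoord x₀ (c' (1 : ℝ))) with hΓ
  set G := g.coord x₀ (c t) with hGdef
  have hG : HasDerivWithinAt (fun τ ↦ g.coord x₀ (c τ))
      (G ∘L Γ + (Γ.precomp ℝ) ∘L G) s t := by
    refine hasDerivWithinAt_clm_of_apply fun u ↦ hasDerivWithinAt_clm_of_apply fun v ↦ ?_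
    have h1 : HasMFDerivWithinAt 𝓘(ℝ, ℝ) 𝓘(ℝ, ℝ)
        ((fun m ↦ g.form m (constField I x₀ u m) (constField I x₀ v m)) ∘ c) s t _ :=
      ((g.contMDiffAt_form_constField hct u v).mdifferentiableAt (by simp)).hasMFDerivAt
        |>.comp_hasMFDerivWithinAt t hc
    have h2 := HasFDerivWithinAt.hasDerivWithinAt (𝕜 := ℝ) (F := ℝ) h1.hasFDerivWithinAt
    have h3 := hg.mvfderiv_coord hct u v (c' (1 : ℝ))
    rw [← christoffel_tangentCoord cov hct, ← christoffel_tangentCoord cov hct] at h3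
    have h4 := h2.congr_deriv (g' := (G ∘L Γ + (Γ.precomp ℝ) ∘L G) u v) h3
    refine h4.congr_of_eventuallyEq ?_ (g.coord_apply hct u v)
    have h5 : ∀ᶠ τ in 𝓝[s] t, c τ ∈ (tangentTriv I x₀).baseSet :=
      hc.continuousWithinAt.eventually ((tangentTriv I x₀).open_baseSet.mem_nhds hct)
    filter_upwards [h5] with τ hτ using g.coord_apply hτ u v
  have h := (hG.clm_apply hy).clm_apply hz
  refine h.congr_deriv ?_
  simp only [← hGdef, add_apply, ContinuousLinearMap.comp_apply, map_neg,
    ContinuousLinearMap.precomp_apply, neg_apply]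
  ring

end AlongCurve

section ParallelTransport

variable {E : Type*} [NormedAddCommGroup E] [NormedSpace ℝ E]
  {H : Type*} [TopologicalSpace H] {I : ModelWithCorners ℝ E H}
  {M : Type*} [TopologicalSpace M] [ChartedSpace H M] [IsManifold I ∞ M]
  {cov : CovariantDerivative I E (TangentSpace I : M → Type _)} {γ : ℝ → M}

theorem ContMDiffOn.eventually_mem_baseSet (hγ : ContMDiffOn 𝓘(ℝ, ℝ) I ∞ γ (Icc 0 1))
    {t : ℝ} (ht : t ∈ Icc (0 : ℝ) 1) :
    ∀ᶠ s in 𝓝[Icc 0 1] t, γ s ∈ (tangentTriv I (γ t)).baseSet :=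
  (hγ t ht).continuousWithinAt.eventually
    ((tangentTriv I (γ t)).open_baseSet.mem_nhds (mem_baseSet_tangentTriv (γ t)))

variable [FiniteDimensional ℝ E]

theorem isParallelAlong_iff {Y : ∀ t : ℝ, TangentSpace I (γ t)} :
    IsParallelAlong cov γ Y ↔ ∀ t ∈ Icc (0 : ℝ) 1,
      HasDerivWithinAt (fun s ↦ tangentCoord (γ t) (Y s))
        (-christoffel cov (γ t) (γ t)
          (tangentCoord (γ t) (mfderivWithin 𝓘(ℝ, ℝ) I γ (Icc 0 1) t (1 : ℝ)))
          (tangentCoord (γ t) (Y t))) (Icc 0 1) t := by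
  refine forall₂_congr fun t _ ↦ ?_
  rw [christoffel_tangentCoord cov (mem_baseSet_tangentTriv (γ t))]
  rfl

/-- Linear combinations of parallel fields are parallel. -/
theorem IsParallelAlong.sum_smul (hγ : ContMDiffOn 𝓘(ℝ, ℝ) I ∞ γ (Icc 0 1))
    {ι : Type*} [Fintype ι] {Y : ι → ∀ t : ℝ, TangentSpace I (γ t)}
    (hY : ∀ i, IsParallelAlong cov γ (Y i)) (a : ι → ℝ) :
    IsParallelAlong cov γ (fun t ↦ ∑ i, a i • Y i t) := by
  rw [isParallelAlong_iff]
  intro t ht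
  have hsum (s : ℝ) (hs : γ s ∈ (tangentTriv I (γ t)).baseSet) :
      tangentCoord (γ t) (∑ i, a i • Y i s) = ∑ i, a i • tangentCoord (γ t) (Y i s) := by
    simp only [tangentCoord_eq_continuousLinearEquivAt hs, map_sum, map_smul]
  have h := HasDerivWithinAt.fun_sum (u := Finset.univ)
    fun i _ ↦ (isParallelAlong_iff.mp (hY i) t ht).const_smul (a i)
  rw [hsum t (mem_baseSet_tangentTriv (γ t))]
  refine (h.congr_of_eventuallyEq ?_ (hsum t (mem_baseSet_tangentTriv _))).congr_deriv ?_
  · filter_upwards [hγ.eventually_mem_baseSet ht] with s hs using hsum s hs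
  · simp only [map_sum, map_smul, smul_neg, Finset.sum_neg_distrib]

/-- The value of a parallel metric on two parallel fields is constant. -/
theorem SemiRiemannianMetric.IsParallel.form_eq_of_isParallelAlong {g : SemiRiemannianMetric I M}
    (hg : g.IsParallel cov) (hγ : ContMDiffOn 𝓘(ℝ, ℝ) I ∞ γ (Icc 0 1))
    {Y Z : ∀ t : ℝ, TangentSpace I (γ t)} (hY : IsParallelAlong cov γ Y)
    (hZ : IsParallelAlong cov γ Z) {t : ℝ} (ht : t ∈ Icc (0 : ℝ) 1) :
    g.form (γ t) (Y t) (Z t) = g.form (γ 0) (Y 0) (Z 0) := by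
  have hderiv (t : ℝ) (ht : t ∈ Icc (0 : ℝ) 1) :
      HasDerivWithinAt (fun t ↦ g.form (γ t) (Y t) (Z t)) 0 (Icc 0 1) t := by
    have hbase := mem_baseSet_tangentTriv (I := I) (γ t)
    have hcurve := ((hγ t ht).mdifferentiableWithinAt (by simp)).hasMFDerivWithinAt
    have h := hg.hasDerivWithinAt_coord hbase hcurve
      (isParallelAlong_iff.mp hY t ht) (isParallelAlong_iff.mp hZ t ht)
    have heq (s : ℝ) (hs : γ s ∈ (tangentTriv I (γ t)).baseSet) : g.form (γ s) (Y s) (Z s) =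
        g.coord (γ t) (γ s) (tangentCoord (γ t) (Y s)) (tangentCoord (γ t) (Z s)) := by
      rw [g.coord_apply hs, constField_tangentCoord hs, constField_tangentCoord hs]
    refine h.congr_of_eventuallyEq ?_ (heq t hbase)
    filter_upwards [hγ.eventually_mem_baseSet ht] with s hs using heq s hs
  exact constant_of_derivWithin_zero (fun s hs ↦ (hderiv s hs).differentiableWithinAt)
    (fun s hs ↦ (hderiv s ⟨hs.1, hs.2.le⟩).derivWithin
      ((uniqueDiffOn_Icc zero_lt_one) s ⟨hs.1, hs.2.le⟩)) t ht

/-- A parallel transport extends to a linear family of parallel fields. -/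
theorem IsParallelTransportAlong.exists_family {x y : M}
    {φ : TangentSpace I x ≃ₗ[ℝ] TangentSpace I y} (h : IsParallelTransportAlong cov γ φ) :
    ∃ P : ∀ t : ℝ, TangentSpace I x →ₗ[ℝ] TangentSpace I (γ t),
      (∀ v, IsParallelAlong cov γ (fun t ↦ P t v)) ∧
      (∀ v, TotalSpace.mk' E (γ 0) (P 0 v) = TotalSpace.mk' E x v) ∧
      ∀ v, TotalSpace.mk' E (γ 1) (P 1 v) = TotalSpace.mk' E y (φ v) := by
  obtain rfl := h.source
  obtain rfl := h.target
  have : FiniteDimensional ℝ (TangentSpace I (γ 0)) := inferInstanceAs (FiniteDimensional ℝ E)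
  let b := Module.finBasis ℝ (TangentSpace I (γ 0))
  choose Y hY h0 h1 using fun i ↦ h.transport (b i)
  refine ⟨fun t ↦ b.constr ℝ fun i ↦ Y i t, fun v ↦ ?_, fun v ↦ ?_, fun v ↦ ?_⟩
  · simp only [Module.Basis.constr_apply_fintype]
    exact IsParallelAlong.sum_smul h.smooth hY _
  · have h0' : (fun i ↦ Y i 0) = fun i ↦ b i :=
      funext fun i ↦ (TotalSpace.mk_inj.mp (h0 i))
    refine congrArg (TotalSpace.mk' E (γ 0)) ?_
    change b.constr ℝ (fun i ↦ Y i 0) v = v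
    rw [h0']
    exact LinearMap.congr_fun (b.constr_eq ℝ (f := LinearMap.id) fun i ↦ rfl) v
  · have h1' : (fun i ↦ Y i 1) = fun i ↦ φ (b i) :=
      funext fun i ↦ (TotalSpace.mk_inj.mp (h1 i))
    refine congrArg (TotalSpace.mk' E (γ 1)) ?_
    change b.constr ℝ (fun i ↦ Y i 1) v = φ v
    rw [h1']
    exact LinearMap.congr_fun (b.constr_eq ℝ (f := φ.toLinearMap) fun i ↦ rfl) v

theorem IsParallelTransport.form_eq {x y : M} {φ : TangentSpace I x ≃ₗ[ℝ] TangentSpace I y}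
    (hφ : IsParallelTransport cov φ) {g : SemiRiemannianMetric I M} (hg : g.IsParallel cov)
    (v w : TangentSpace I x) : g.form y (φ v) (φ w) = g.form x v w := by
  induction hφ with
  | refl => rfl
  | trans γ _ hψ ih =>
    refine Eq.trans ?_ ih
    obtain ⟨P, hP, h0, h1⟩ := hψ.exists_family
    obtain rfl := hψ.source
    obtain rfl := hψ.target
    have h (v w) := hg.form_eq_of_isParallelAlong hψ.smooth (hP v) (hP w)
      (right_mem_Icc.2 zero_le_one)
    have h0' (v) : P 0 v = v := TotalSpace.mk_inj.mp (h0 v)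
    have h1' (v) : P 1 v = _ := TotalSpace.mk_inj.mp (h1 v)
    simp only [h0', h1'] at h
    exact h _ _

end ParallelTransport

section FundamentalSolution

variable {E : Type*} [NormedAddCommGroup E] [NormedSpace ℝ E] [CompleteSpace E]

set_option synthInstance.maxHeartbeats 200000 in
/-- The fundamental solution of a linear differential equation on the unit interval. -/
theorem exists_fundamentalSolution {A : ℝ → E →L[ℝ] E} (hA : ContinuousOn A (Icc 0 1))
    (hbound : ∀ t ∈ Icc (0 : ℝ) 1, ‖A t‖ ≤ 1 / 2) :
    ∃ Y : ℝ → E →L[ℝ] E, Y 0 = ContinuousLinearMap.id ℝ E ∧ ∀ u, ∀ t ∈ Icc (0 : ℝ) 1,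
      HasDerivWithinAt (fun τ ↦ Y τ u) (A t (Y t u)) (Icc 0 1) t := by
  let B : ℝ → (E →L[ℝ] E) →L[ℝ] (E →L[ℝ] E) := fun t ↦ ContinuousLinearMap.compL ℝ E E E (A t)
  have hBcont : ContinuousOn B (Icc 0 1) :=
    (ContinuousLinearMap.compL ℝ E E E).continuous.comp_continuousOn hA
  have hBnorm (t : ℝ) (ht : t ∈ Icc (0 : ℝ) 1) : ‖B t‖ ≤ 1 / 2 :=
    ContinuousLinearMap.opNorm_le_bound _ (by norm_num) fun L ↦
      (ContinuousLinearMap.opNorm_comp_le (A t) L).trans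
        (mul_le_mul_of_nonneg_right (hbound t ht) (norm_nonneg L))
  obtain ⟨Y, hY0, hY⟩ := exists_hasDerivWithinAt_linear hBcont hBnorm (ContinuousLinearMap.id ℝ E)
  refine ⟨Y, hY0, fun u t ht ↦ ?_⟩
  refine ((hY t ht).clm_apply (hasDerivWithinAt_const t (Icc 0 1) u)).congr_deriv ?_
  rw [map_zero, add_zero]
  rfl

end FundamentalSolution

section Isometry

variable {E : Type*} [NormedAddCommGroup E] [NormedSpace ℝ E]
  {H : Type*} [TopologicalSpace H] {I : ModelWithCorners ℝ E H} [I.Boundaryless]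
  {M : Type*} [TopologicalSpace M] [ChartedSpace H M] [IsManifold I ∞ M]
  {cov : CovariantDerivative I E (TangentSpace I : M → Type _)}

/-- A curve that is a segment in the chart at `x₀` has constant coordinate velocity. -/
theorem exists_hasMFDerivWithinAt_segment {x₀ : M} {a w : E} {t : ℝ}
    (ht : a + t • w ∈ (extChartAt I x₀).target) (s : Set ℝ) :
    ∃ c' : TangentSpace 𝓘(ℝ, ℝ) t →L[ℝ] TangentSpace I ((extChartAt I x₀).symm (a + t • w)),
      HasMFDerivWithinAt 𝓘(ℝ, ℝ) I (fun τ : ℝ ↦ (extChartAt I x₀).symm (a + τ • w)) s t c' ∧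
      tangentCoord x₀ (c' (1 : ℝ)) = w := by
  have hz : (extChartAt I x₀).symm (a + t • w) ∈ (chartAt H x₀).source := by
    rw [← extChartAt_source I]
    exact (extChartAt I x₀).map_target ht
  have h1 : HasFDerivAt (fun τ : ℝ ↦ a + τ • w) ((ContinuousLinearMap.id ℝ ℝ).smulRight w) t :=
    ((hasFDerivAt_id t).smul_const w).const_add a
  have h2 := (mdifferentiableWithinAt_extChartAt_symm ht).hasMFDerivWithinAt
  have h3 := h2.comp t (h1.hasMFDerivAt.hasMFDerivWithinAt (s := s))
    (fun τ _ ↦ by rw [I.range_eq_univ]; trivial)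
  refine ⟨_, h3, ?_⟩
  have h4 := TangentBundle.symmL_trivializationAt (𝕜 := ℝ) (I := I) hz
  rw [(extChartAt I x₀).right_inv ht] at h4
  rw [← h4]
  have hbase : (extChartAt I x₀).symm (a + t • w) ∈ (tangentTriv I x₀).baseSet := hz
  change tangentCoord x₀ ((tangentTriv I x₀).symmL ℝ _ ((1 : ℝ) • w)) = w
  rw [one_smul, (tangentTriv I x₀).symmL_apply hbase]
  exact tangentCoord_constField hbase w

variable [FiniteDimensional ℝ E]

set_option synthInstance.maxHeartbeats 200000 in
/-- Parallel transport along short segments in a chart. -/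
theorem eventually_exists_isometry [T2Space M]
    (hcov : CovariantDerivative.ContMDiffCovariantDerivative cov ∞)
    {g₀ : SemiRiemannianMetric I M} (hg₀ : g₀.IsParallel cov) (x₀ : M) :
    ∀ᶠ y in 𝓝 x₀, ∃ P : TangentSpace I x₀ ≃ₗ[ℝ] TangentSpace I y,
      ∀ g : SemiRiemannianMetric I M, g.IsParallel cov →
        ∀ v w, g.form y (P v) (P w) = g.form x₀ v w := by
  set φ := extChartAt I x₀ with hφ
  have hx₀ := mem_baseSet_tangentTriv (I := I) x₀
  set C := ‖christoffel cov x₀ x₀‖ + 1 with hC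
  have hcont := eventually_continuousAt_christoffel cov hcov x₀
  have hnorm : ∀ᶠ y in 𝓝 x₀, ‖christoffel cov x₀ y‖ < C :=
    (ContinuousAt.norm (E := E →L[ℝ] E →L[ℝ] E) hcont.self_of_nhds).eventually_lt_const
      (by rw [hC]; linarith)
  have hgood := (hcont.and hnorm).and ((tangentTriv I x₀).open_baseSet.mem_nhds hx₀)
  have hsymm : Filter.Tendsto φ.symm (𝓝 (φ x₀)) (𝓝 x₀) := by
    have := continuousAt_extChartAt_symm (I := I) x₀
    rwa [ContinuousAt, extChartAt_to_inv] at this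
  obtain ⟨r, hr, hball⟩ := Metric.eventually_nhds_iff_ball.mp
    ((hsymm.eventually hgood).and (extChartAt_target_mem_nhds (I := I) x₀))
  have hCpos : 0 < C := by positivity
  have hrad : 0 < min r (1 / (2 * C)) := by positivity
  filter_upwards [(continuousAt_extChartAt (I := I) x₀).eventually
    (Metric.ball_mem_nhds _ hrad), extChartAt_source_mem_nhds (I := I) x₀] with y hy hysource
  set w := φ y - φ x₀ with hw
  have hwnorm : ‖w‖ < min r (1 / (2 * C)) := by rwa [hw, ← dist_eq_norm]
  have hseg (t : ℝ) (ht : t ∈ Icc (0 : ℝ) 1) : φ x₀ + t • w ∈ Metric.ball (φ x₀) r := by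
    rw [mem_ball_iff_norm, add_sub_cancel_left, norm_smul, Real.norm_of_nonneg ht.1]
    calc t * ‖w‖ ≤ 1 * ‖w‖ := by gcongr; exact ht.2
      _ < r := by rw [one_mul]; exact hwnorm.trans_le (min_le_left _ _)
  set c : ℝ → M := fun t ↦ φ.symm (φ x₀ + t • w) with hc
  have hc0 : c 0 = x₀ := by simp [hc, hφ]
  have hc1 : c 1 = y := by
    simp only [hc, hw, one_smul, add_sub_cancel]
    exact (extChartAt I x₀).left_inv hysource
  have hgoodc (t : ℝ) (ht : t ∈ Icc (0 : ℝ) 1) := (hball _ (hseg t ht)).1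
  have htarget (t : ℝ) (ht : t ∈ Icc (0 : ℝ) 1) := (hball _ (hseg t ht)).2
  set A : ℝ → E →L[ℝ] E := fun t ↦ -christoffel cov x₀ (c t) w with hA
  have hAcont : ContinuousOn A (Icc 0 1) := by
    intro t ht
    obtain ⟨c', hc', -⟩ := exists_hasMFDerivWithinAt_segment (htarget t ht) (Icc 0 1)
    have hcc : ContinuousWithinAt c (Icc 0 1) t := hc'.continuousWithinAt
    have hct : ContinuousAt (christoffel cov x₀) (c t) := (hgoodc t ht).1.1
    exact ((hct.comp_continuousWithinAt hcc).clm_apply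
      continuousWithinAt_const).neg
  have hAnorm (t : ℝ) (ht : t ∈ Icc (0 : ℝ) 1) : ‖A t‖ ≤ 1 / 2 := by
    rw [hA, norm_neg]
    calc ‖christoffel cov x₀ (c t) w‖ ≤ ‖christoffel cov x₀ (c t)‖ * ‖w‖ :=
          ContinuousLinearMap.le_opNorm _ _
      _ ≤ C * (1 / (2 * C)) := by
        gcongr
        · exact (hgoodc t ht).1.2.le
        · exact (hwnorm.trans_le (min_le_right _ _)).le
      _ = 1 / 2 := by field_simp
  obtain ⟨Y, hY0, hYu⟩ := exists_fundamentalSolution hAcont hAnorm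
  have hbase1 : y ∈ (tangentTriv I x₀).baseSet := by
    have := (hgoodc 1 (right_mem_Icc.2 zero_le_one)).2
    rwa [← hc1]
  have hconst (g : SemiRiemannianMetric I M) (hg : g.IsParallel cov) (u v : E) :
      g.coord x₀ y (Y 1 u) (Y 1 v) = g.coord x₀ x₀ u v := by
    have hderiv (t : ℝ) (ht : t ∈ Icc (0 : ℝ) 1) :
        HasDerivWithinAt (fun τ ↦ g.coord x₀ (c τ) (Y τ u) (Y τ v)) 0 (Icc 0 1) t := by
      obtain ⟨c', hc', hcw⟩ := exists_hasMFDerivWithinAt_segment (htarget t ht) (Icc 0 1)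
      refine hg.hasDerivWithinAt_coord (c := c) (hgoodc t ht).2 hc' ?_ ?_
      · exact (hYu u t ht).congr_deriv (by rw [hcw]; rfl)
      · exact (hYu v t ht).congr_deriv (by rw [hcw]; rfl)
    have h := constant_of_derivWithin_zero (fun s hs ↦ (hderiv s hs).differentiableWithinAt)
      (fun s hs ↦ (hderiv s ⟨hs.1, hs.2.le⟩).derivWithin
        ((uniqueDiffOn_Icc zero_lt_one) s ⟨hs.1, hs.2.le⟩)) 1 (right_mem_Icc.2 zero_le_one)
    rw [hc0, hc1, hY0] at h
    exact h
  let e₀ := (tangentTriv I x₀).continuousLinearEquivAt ℝ x₀ hx₀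
  let e₁ := (tangentTriv I x₀).continuousLinearEquivAt ℝ y hbase1
  let Q : TangentSpace I x₀ →ₗ[ℝ] TangentSpace I y :=
    e₁.symm.toLinearMap ∘ₗ (Y 1).toLinearMap ∘ₗ e₀.toLinearMap
  have hQ (g : SemiRiemannianMetric I M) (hg : g.IsParallel cov) (v w : TangentSpace I x₀) :
      g.form y (Q v) (Q w) = g.form x₀ v w := by
    have h := hconst g hg (e₀ v) (e₀ w)
    rw [g.coord_apply hbase1, g.coord_apply hx₀] at h
    simp only [constField_eq_symm_continuousLinearEquivAt hbase1,
      constField_eq_symm_continuousLinearEquivAt hx₀] at h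
    rw [ContinuousLinearEquiv.symm_apply_apply, ContinuousLinearEquiv.symm_apply_apply] at h
    exact h
  have hinj : Function.Injective Q := by
    refine (injective_iff_map_eq_zero Q).mpr fun v hv ↦ g₀.nondegenerate x₀ v fun w ↦ ?_
    rw [← hQ g₀ hg₀, hv, map_zero]
    rfl
  have : FiniteDimensional ℝ (TangentSpace I x₀) := inferInstanceAs (FiniteDimensional ℝ E)
  have : FiniteDimensional ℝ (TangentSpace I y) := inferInstanceAs (FiniteDimensional ℝ E)
  exact ⟨LinearMap.linearEquivOfInjective Q hinj rfl, hQ⟩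

/-- On a connected manifold, any two tangent spaces are isometric simultaneously for all parallel
metrics. -/
theorem exists_isometry [T2Space M] [PreconnectedSpace M]
    (hcov : CovariantDerivative.ContMDiffCovariantDerivative cov ∞)
    {g₀ : SemiRiemannianMetric I M} (hg₀ : g₀.IsParallel cov) (x y : M) :
    ∃ P : TangentSpace I x ≃ₗ[ℝ] TangentSpace I y,
      ∀ g : SemiRiemannianMetric I M, g.IsParallel cov →
        ∀ v w, g.form y (P v) (P w) = g.form x v w := by
  let S : Set M := {y | ∃ P : TangentSpace I x ≃ₗ[ℝ] TangentSpace I y,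
      ∀ g : SemiRiemannianMetric I M, g.IsParallel cov →
        ∀ v w, g.form y (P v) (P w) = g.form x v w}
  have hS : IsClopen S := by
    constructor
    · rw [← isOpen_compl_iff, isOpen_iff_mem_nhds]
      intro y hy
      filter_upwards [eventually_exists_isometry hcov hg₀ y] with z ⟨P, hP⟩ ⟨Q, hQ⟩
      refine hy ⟨Q.trans P.symm, fun g hg v w ↦ ?_⟩
      rw [← hQ g hg, ← hP g hg]
      simp
    · rw [isOpen_iff_mem_nhds]
      rintro y ⟨Q, hQ⟩
      filter_upwards [eventually_exists_isometry hcov hg₀ y] with z ⟨P, hP⟩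
      exact ⟨Q.trans P, fun g hg v w ↦ by rw [← hQ g hg, ← hP g hg]; rfl⟩
  have huniv := hS.eq_univ ⟨x, LinearEquiv.refl ℝ _, fun _ _ _ _ ↦ rfl⟩
  exact huniv.symm.subset (mem_univ y)

/-- Independent parallel metrics on a connected manifold are independent at each point. -/
theorem SemiRiemannianMetric.Independent.linearIndependent_form [T2Space M] [PreconnectedSpace M]
    (hcov : CovariantDerivative.ContMDiffCovariantDerivative cov ∞) {ι : Type*} [Fintype ι]
    {g : ι → SemiRiemannianMetric I M} (hg : SemiRiemannianMetric.Independent g)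
    (hpar : ∀ i, (g i).IsParallel cov) (x : M) {a : ι → ℝ}
    (ha : ∀ v w, ∑ i, a i * (g i).form x v w = 0) (i : ι) : a i = 0 := by
  refine Fintype.linearIndependent_iff.mp hg a ?_ i
  funext y v w
  obtain ⟨P, hP⟩ := exists_isometry hcov (hpar i) y x
  have h := ha (P v) (P w)
  simp only [fun j ↦ hP (g j) (hpar j) v w] at h
  simpa [Finset.sum_apply] using h

end Isometry

section EndomorphismFields

variable {E : Type*} [NormedAddCommGroup E] [InnerProductSpace ℝ E]
  {H : Type*} [TopologicalSpace H] {I : ModelWithCorners ℝ E H}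
  {M : Type*} [TopologicalSpace M] [ChartedSpace H M] [IsManifold I ∞ M]
  {x₀ y : M}

/-- The coordinates of tangent vectors at `y` in the chart at `x₀` as a linear equivalence. -/
def tangentEquiv (hy : y ∈ (tangentTriv I x₀).baseSet) : TangentSpace I y ≃ₗ[ℝ] E :=
  ((tangentTriv I x₀).continuousLinearEquivAt ℝ y hy).toLinearEquiv

theorem tangentEquiv_apply (hy : y ∈ (tangentTriv I x₀).baseSet) (v : TangentSpace I y) :
    tangentEquiv hy v = tangentCoord x₀ v := rfl

theorem tangentEquiv_symm_apply (hy : y ∈ (tangentTriv I x₀).baseSet) (u : E) :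
    (tangentEquiv hy).symm u = constField I x₀ u y :=
  (constField_eq_symm_continuousLinearEquivAt hy u).symm

variable [FiniteDimensional ℝ E]

/-- The coordinates, in the chart at `x₀`, of a field of endomorphisms of the tangent spaces. -/
def endCoord (x₀ : M) (K : ∀ y : M, Module.End ℝ (TangentSpace I y)) (y : M) : E →L[ℝ] E :=
  LinearMap.toContinuousLinearMap (((tangentTriv I x₀).continuousLinearMapAt ℝ y).toLinearMap ∘ₗ
    K y ∘ₗ ((tangentTriv I x₀).symmL ℝ y).toLinearMap)

theorem endCoord_apply {K : ∀ y : M, Module.End ℝ (TangentSpace I y)}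
    (hy : y ∈ (tangentTriv I x₀).baseSet) (u : E) :
    endCoord x₀ K y u = tangentCoord x₀ (K y (constField I x₀ u y)) := by
  change (tangentTriv I x₀).continuousLinearMapAt ℝ y (K y ((tangentTriv I x₀).symmL ℝ y u)) = _
  rw [(tangentTriv I x₀).symmL_apply hy, (tangentTriv I x₀).continuousLinearMapAt_apply_of_mem ℝ hy]
  rfl

theorem endCoord_tangentCoord {K : ∀ y : M, Module.End ℝ (TangentSpace I y)}
    (hy : y ∈ (tangentTriv I x₀).baseSet) (v : TangentSpace I y) :
    endCoord x₀ K y (tangentCoord x₀ v) = tangentCoord x₀ (K y v) := by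
  rw [endCoord_apply hy, constField_tangentCoord hy]

/-- Continuity of the coordinates of a field of endomorphisms does not depend on the chart. -/
theorem continuousAt_endCoord {K : ∀ y : M, Module.End ℝ (TangentSpace I y)} {x : M}
    (hx : x ∈ (tangentTriv I x₀).baseSet) (hK : ContinuousAt (endCoord x₀ K) x) :
    ContinuousAt (endCoord x K) x := by
  have hxx := mem_baseSet_tangentTriv (I := I) x
  have hopen := (((tangentTriv I x₀).open_baseSet.inter (tangentTriv I x).open_baseSet).mem_nhds
    ⟨hx, hxx⟩)
  have h1 : ContinuousAt (fun y ↦ ((tangentTriv I x₀).coordChangeL ℝ (tangentTriv I x) y :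
      E →L[ℝ] E)) x :=
    (continuousOn_coordChange ℝ (tangentTriv I x₀) (tangentTriv I x)).continuousAt hopen
  have h2 : ContinuousAt (fun y ↦ ((tangentTriv I x).coordChangeL ℝ (tangentTriv I x₀) y :
      E →L[ℝ] E)) x :=
    (continuousOn_coordChange ℝ (tangentTriv I x) (tangentTriv I x₀)).continuousAt
      (by rwa [inter_comm])
  refine (h1.clm_comp (hK.clm_comp h2)).congr ?_
  filter_upwards [hopen] with y hy
  ext1 u
  change (tangentTriv I x₀).coordChangeL ℝ (tangentTriv I x) y (endCoord x₀ K y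
    ((tangentTriv I x).coordChangeL ℝ (tangentTriv I x₀) y u)) = _
  rw [(tangentTriv I x).coordChangeL_apply _ hy.symm]
  change (tangentTriv I x₀).coordChangeL ℝ (tangentTriv I x) y (endCoord x₀ K y
    (tangentCoord x₀ (constField I x u y))) = _
  rw [endCoord_tangentCoord hy.1, (tangentTriv I x₀).coordChangeL_apply _ hy, endCoord_apply hy.2]
  change tangentCoord x (constField I x₀ (tangentCoord x₀ (K y (constField I x u y))) y) = _
  rw [constField_tangentCoord hy.1]

/-- The field of endomorphisms `K` is continuous at `x` (in the chart at `x`). -/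
def IsContinuousEndAt (K : ∀ y : M, Module.End ℝ (TangentSpace I y)) (x : M) : Prop :=
  ContinuousAt (endCoord x K) x

variable (g₁ g₂ : SemiRiemannianMetric I M)

/-- `K` is a common skew root of the metrics `g₁` and `g₂` at `x`. -/
def IsMetricSkewRootAt (K : ∀ y : M, Module.End ℝ (TangentSpace I y)) (x : M) : Prop :=
  IsCommonSkewRoot (g₁.form x).toBilinForm (g₂.form x).toBilinForm (K x)

variable {g₁ g₂}

theorem exists_local_isMetricSkewRootAt {α β : ℝ} (hβ : β ≠ 0)
    (h : ∀ x, IsComplexPair α β (g₁.form x).toBilinForm (g₂.form x).toBilinForm) (x₀ : M) :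
    ∃ K : ∀ y : M, Module.End ℝ (TangentSpace I y),
      ∀ᶠ x in 𝓝 x₀, IsContinuousEndAt K x ∧ IsMetricSkewRootAt g₁ g₂ K x := by
  have hbase := (tangentTriv I x₀).open_baseSet.mem_nhds (mem_baseSet_tangentTriv x₀)
  have hcont (g : SemiRiemannianMetric I M) : ∀ᶠ x in 𝓝 x₀, ContinuousAt (g.coord x₀) x := by
    filter_upwards [hbase] with x hx using g.continuousAt_coord hx
  have hform (g : SemiRiemannianMetric I M) {x : M} (hx : x ∈ (tangentTriv I x₀).baseSet)
      (u v : E) : (g.form x).toBilinForm ((tangentEquiv hx).symm u) ((tangentEquiv hx).symm v) =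
        (g.coord x₀ x).toBilinForm u v := by
    rw [tangentEquiv_symm_apply, tangentEquiv_symm_apply]
    exact (g.coord_apply hx u v).symm
  have hpair : ∀ᶠ x in 𝓝 x₀,
      IsComplexPair α β (g₁.coord x₀ x).toBilinForm (g₂.coord x₀ x).toBilinForm := by
    filter_upwards [hbase] with x hx
    refine (h x).map (tangentEquiv hx) (fun u v ↦ ?_) fun u v ↦ ?_ <;>
    rw [← hform _ hx, LinearEquiv.symm_apply_apply, LinearEquiv.symm_apply_apply]
  obtain ⟨D, hD⟩ := exists_continuousAt_isCommonSkewRoot hβ (hcont g₁) (hcont g₂) hpair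
  classical
  let K : ∀ y : M, Module.End ℝ (TangentSpace I y) := fun y ↦
    if hy : y ∈ (tangentTriv I x₀).baseSet then
      (tangentEquiv hy).symm.toLinearMap ∘ₗ (D y).toLinearMap ∘ₗ (tangentEquiv hy).toLinearMap
    else 0
  refine ⟨K, ?_⟩
  filter_upwards [hD, hbase] with x ⟨hDx, hroot⟩ hx
  refine ⟨continuousAt_endCoord hx (hDx.congr ?_), ?_⟩
  · filter_upwards [(tangentTriv I x₀).open_baseSet.mem_nhds hx] with y hy
    ext1 u
    rw [endCoord_apply hy, ← tangentEquiv_apply hy, ← tangentEquiv_symm_apply hy]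
    simp only [K, dif_pos hy, LinearMap.comp_apply, LinearEquiv.coe_coe,
      LinearEquiv.apply_symm_apply, ContinuousLinearMap.coe_coe]
  · have := hroot.map (tangentEquiv hx).symm (hform g₁ hx) (hform g₂ hx)
    simp only [IsMetricSkewRootAt, K, dif_pos hx]
    exact this

theorem IsCommonSkewRoot.injective {V : Type*} [AddCommGroup V] [Module ℝ V]
    {b c : LinearMap.BilinForm ℝ V} {D : Module.End ℝ V} (h : IsCommonSkewRoot b c D) :
    Function.Injective D := by
  refine (injective_iff_map_eq_zero D).mpr fun v hv ↦ ?_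
  have := h.sq v
  rw [hv, map_zero] at this
  exact neg_eq_zero.mp this.symm

/-- On a simply connected manifold, the local skew roots can be chosen continuously. -/
theorem exists_continuous_isMetricSkewRootAt [SimplyConnectedSpace M] [LocallyPathConnectedSpace M]
    [Nontrivial E] {α β : ℝ} (hβ : β ≠ 0)
    (h : ∀ x, IsComplexPair α β (g₁.form x).toBilinForm (g₂.form x).toBilinForm) :
    ∃ K : ∀ y : M, Module.End ℝ (TangentSpace I y),
      ∀ x, IsContinuousEndAt K x ∧ IsMetricSkewRootAt g₁ g₂ K x := by
  choose L hL using exists_local_isMetricSkewRootAt hβ h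
  let K₀ : ∀ y : M, Module.End ℝ (TangentSpace I y) := fun y ↦ L y y
  let U : M → Set M := fun i ↦ interior {x | IsContinuousEndAt (L i) x ∧
    IsMetricSkewRootAt g₁ g₂ (L i) x}
  have hmem (i : M) : i ∈ U i := mem_interior_iff_mem_nhds.mpr (hL i)
  have hsub (i : M) {x : M} (hx : x ∈ U i) : IsContinuousEndAt (L i) x ∧
      IsMetricSkewRootAt g₁ g₂ (L i) x := by
    have h1 := interior_subset hx
    exact h1
  have hK₀ (y : M) : IsMetricSkewRootAt g₁ g₂ K₀ y := (hL y).self_of_nhds.2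
  have hsign (i y : M) : ∃ s : ℤˣ, y ∈ U i → L i y = ((s : ℤ) : ℝ) • K₀ y := by
    by_cases hy : y ∈ U i
    · rcases (h y).eq_or_eq_neg hβ (hK₀ y) (hsub i hy).2 with h1 | h1
      · exact ⟨1, fun _ ↦ by simpa using h1⟩
      · exact ⟨-1, fun _ ↦ by simpa using h1⟩
    · exact ⟨1, fun h' ↦ absurd h' hy⟩
  choose s hs using hsign
  have hsq (a : ℤˣ) : ((a : ℤ) : ℝ) * ((a : ℤ) : ℝ) = 1 := by
    rcases Int.units_eq_one_or a with rfl | rfl <;> simp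
  have hratio {i j y : M} (hi : y ∈ U i) (hj : y ∈ U j) :
      L i y = ((((s i y * s j y : ℤˣ) : ℤ)) : ℝ) • L j y := by
    rw [hs i y hi, hs j y hj, smul_smul, Units.val_mul, Int.cast_mul, mul_assoc, hsq, mul_one]
  obtain ⟨w, hw⟩ := exists_ne (0 : E)
  obtain ⟨ε, hε⟩ := exists_sign_of_simplyConnected U (fun i ↦ isOpen_interior) hmem s (by
    intro i j x hx
    have hbase := (tangentTriv I x).open_baseSet.mem_nhds (mem_baseSet_tangentTriv x)
    have hUi : U i ∈ 𝓝 x := isOpen_interior.mem_nhds hx.1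
    have hUj : U j ∈ 𝓝 x := isOpen_interior.mem_nhds hx.2
    have h1 : ContinuousAt (fun y ↦ endCoord x (L i) y w) x :=
      ContinuousAt.clm_apply (hsub i hx.1).1 continuousAt_const
    have h2 : ContinuousAt (fun y ↦ endCoord x (L j) y w) x :=
      ContinuousAt.clm_apply (hsub j hx.2).1 continuousAt_const
    have h3 := eventually_sign_eq (S := univ) (mem_univ x) (s := fun y ↦ s i y * s j y)
      h1.continuousWithinAt h2.continuousWithinAt ?_ ?_
    · rwa [nhdsWithin_univ] at h3
    · have hxb := mem_baseSet_tangentTriv (I := I) x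
      rw [endCoord_apply hxb, tangentCoord_eq_continuousLinearEquivAt hxb,
        constField_eq_symm_continuousLinearEquivAt hxb]
      intro h0
      rw [ContinuousLinearEquiv.map_eq_zero_iff] at h0
      have h4 := (injective_iff_map_eq_zero _).mp (hsub j hx.2).2.injective _ h0
      rw [ContinuousLinearEquiv.map_eq_zero_iff] at h4
      exact hw h4
    · rw [nhdsWithin_univ]
      filter_upwards [hbase, hUi, hUj] with y hy hi hj
      rw [endCoord_apply hy, endCoord_apply hy, hratio hi hj,
        tangentCoord_eq_continuousLinearEquivAt hy, LinearMap.smul_apply, map_smul]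
      rfl)
  refine ⟨fun y ↦ ((ε y : ℤ) : ℝ) • K₀ y, fun x ↦ ⟨?_, ?_⟩⟩
  · have h0 : ContinuousAt (endCoord x (L x)) x := (hL x).self_of_nhds.1
    have h1 := h0.const_smul (((ε x * s x x : ℤˣ) : ℤ) : ℝ)
    refine h1.congr ?_
    filter_upwards [hε x, isOpen_interior.mem_nhds (hmem x),
      (tangentTriv I x).open_baseSet.mem_nhds (mem_baseSet_tangentTriv x)] with y hy hyU hyb
    ext1 u
    rw [← hy, Pi.smul_apply, smul_apply, endCoord_apply hyb, endCoord_apply hyb, hs x y hyU,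
      tangentCoord_eq_continuousLinearEquivAt hyb, tangentCoord_eq_continuousLinearEquivAt hyb,
      LinearMap.smul_apply, LinearMap.smul_apply, map_smul, map_smul, smul_smul, Units.val_mul,
      Int.cast_mul, mul_assoc, hsq, mul_one]
  · have h1 := hK₀ x
    rcases Int.units_eq_one_or (ε x) with h2 | h2
    · simpa [IsMetricSkewRootAt, h2] using h1
    · refine ⟨fun u ↦ ?_, fun u v ↦ ?_, fun u v ↦ ?_⟩
      · simpa [h2] using h1.sq u
      · simpa [h2, neg_eq_iff_eq_neg] using h1.skew_left u v
      · simpa [h2, neg_eq_iff_eq_neg] using h1.skew_right u v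

end EndomorphismFields

section Holonomy

variable {E : Type*} [NormedAddCommGroup E] [InnerProductSpace ℝ E]
  {H : Type*} [TopologicalSpace H] {I : ModelWithCorners ℝ E H}
  {M : Type*} [TopologicalSpace M] [ChartedSpace H M] [IsManifold I ∞ M]
  {cov : CovariantDerivative I E (TangentSpace I : M → Type _)}
  {g₁ g₂ : SemiRiemannianMetric I M}

/-- A sign that is locally constant on the unit interval is constant. -/
theorem sign_eq_of_locally_eq {s : ℝ → ℤˣ}
    (hs : ∀ t ∈ Icc (0 : ℝ) 1, ∀ᶠ τ in 𝓝[Icc 0 1] t, s τ = s t) : s 1 = s 0 := by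
  have hcont : ContinuousOn (fun t ↦ ((s t : ℤ))) (Icc 0 1) := by
    intro t ht
    have hconst : ContinuousWithinAt (fun _ : ℝ ↦ ((s t : ℤ))) (Icc 0 1) t :=
      continuousWithinAt_const
    refine hconst.congr_of_eventuallyEq ?_ rfl
    filter_upwards [hs t ht] with τ hτ
    rw [hτ]
  exact Units.ext (isPreconnected_Icc.constant hcont (right_mem_Icc.2 zero_le_one)
    (left_mem_Icc.2 zero_le_one))

/-- The holonomy group as a set of endomorphisms. -/
def holonomyEnd (cov : CovariantDerivative I E (TangentSpace I : M → Type _)) (x : M) :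
    Set (Module.End ℝ (TangentSpace I x)) :=
  {φ | ∃ e : TangentSpace I x ≃ₗ[ℝ] TangentSpace I x, IsParallelTransport cov e ∧ φ = e}

theorem actsReducibly_holonomyGroup {x : M} (h : HasInvariantSubspace (holonomyEnd cov x)) :
    ActsReducibly ℝ (TangentSpace I x) (holonomyGroup cov x) := by
  obtain ⟨W, hbot, htop, hW⟩ := h
  exact ⟨W, hbot, htop, fun φ ξ hξ ↦ hW _ ⟨φ.1, φ.2, rfl⟩ ξ hξ⟩

variable [FiniteDimensional ℝ E]

/-- Parallel transport commutes with a continuous field of common skew roots of two parallel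
metrics. -/
theorem IsParallelTransportAlong.map_skewRoot [Nontrivial E] (h₁ : g₁.IsParallel cov)
    (h₂ : g₂.IsParallel cov) {α β : ℝ} (hβ : β ≠ 0)
    (hpair : ∀ x, IsComplexPair α β (g₁.form x).toBilinForm (g₂.form x).toBilinForm)
    {K : ∀ y : M, Module.End ℝ (TangentSpace I y)}
    (hK : ∀ x, IsContinuousEndAt K x ∧ IsMetricSkewRootAt g₁ g₂ K x) {γ : ℝ → M} {x y : M}
    {φ : TangentSpace I x ≃ₗ[ℝ] TangentSpace I y} (hφ : IsParallelTransportAlong cov γ φ)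
    (v : TangentSpace I x) : K y (φ v) = φ (K x v) := by
  obtain ⟨P, hP, h0, h1⟩ := hφ.exists_family
  obtain rfl := hφ.source
  obtain rfl := hφ.target
  have hfin (x : M) : FiniteDimensional ℝ (TangentSpace I x) :=
    inferInstanceAs (FiniteDimensional ℝ E)
  have h0' (v) : P 0 v = v := TotalSpace.mk_inj.mp (h0 v)
  have h1' (v) : P 1 v = φ v := TotalSpace.mk_inj.mp (h1 v)
  have hiso (g : SemiRiemannianMetric I M) (hg : g.IsParallel cov) {t : ℝ}
      (ht : t ∈ Icc (0 : ℝ) 1) (v w) : g.form (γ t) (P t v) (P t w) = g.form (γ 0) v w := by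
    have h := hg.form_eq_of_isParallelAlong hφ.smooth (hP v) (hP w) ht
    rwa [h0', h0'] at h
  have hinj {t : ℝ} (ht : t ∈ Icc (0 : ℝ) 1) : Function.Injective (P t) := by
    refine (injective_iff_map_eq_zero (P t)).mpr fun v hv ↦ g₁.nondegenerate _ v fun w ↦ ?_
    rw [← hiso g₁ h₁ ht, hv, map_zero]
    rfl
  have hsign (t : ℝ) : ∃ s : ℤˣ, t ∈ Icc (0 : ℝ) 1 →
      ∀ v, K (γ t) (P t v) = ((s : ℤ) : ℝ) • P t (K (γ 0) v) := by
    by_cases ht : t ∈ Icc (0 : ℝ) 1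
    · let e : TangentSpace I (γ 0) ≃ₗ[ℝ] TangentSpace I (γ t) :=
        LinearMap.linearEquivOfInjective (P t) (hinj ht) rfl
      have hroot := (hK (γ 0)).2.map e (b' := (g₁.form (γ t)).toBilinForm)
        (c' := (g₂.form (γ t)).toBilinForm) (hiso g₁ h₁ ht) (hiso g₂ h₂ ht)
      rcases (hpair (γ t)).eq_or_eq_neg hβ hroot (hK (γ t)).2 with h | h
      · refine ⟨1, fun _ v ↦ ?_⟩
        have h3 := LinearMap.congr_fun h (e v)
        simp only [LinearMap.comp_apply, LinearEquiv.coe_coe, LinearEquiv.symm_apply_apply] at h3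
        rw [Units.val_one, Int.cast_one, one_smul]
        exact h3
      · refine ⟨-1, fun _ v ↦ ?_⟩
        have h3 := LinearMap.congr_fun h (e v)
        simp only [LinearMap.neg_apply, LinearMap.comp_apply, LinearEquiv.coe_coe,
          LinearEquiv.symm_apply_apply] at h3
        rw [Units.val_neg, Units.val_one, Int.cast_neg, Int.cast_one, neg_one_smul]
        exact h3
    · exact ⟨1, fun h ↦ absurd h ht⟩
  choose s hs using hsign
  have : Nontrivial (TangentSpace I (γ 0)) := inferInstanceAs (Nontrivial E)
  obtain ⟨w, hw⟩ := exists_ne (0 : TangentSpace I (γ 0))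
  have hKw : K (γ 0) w ≠ 0 := fun h ↦ hw ((injective_iff_map_eq_zero _).mp
    (hK (γ 0)).2.injective w h)
  have hconst : s 1 = s 0 := by
    refine sign_eq_of_locally_eq fun t ht ↦ ?_
    have hbase := mem_baseSet_tangentTriv (I := I) (γ t)
    have hcont (v : TangentSpace I (γ 0)) :
        ContinuousWithinAt (fun τ ↦ tangentCoord (γ t) (P τ v)) (Icc 0 1) t :=
      (hP v t ht).continuousWithinAt
    have hKc : ContinuousWithinAt (fun τ ↦ endCoord (γ t) K (γ τ)) (Icc 0 1) t :=
      ContinuousAt.comp_continuousWithinAt (g := endCoord (γ t) K) (hK (γ t)).1 (hφ.smooth t ht).continuousWithinAt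
    refine eventually_sign_eq ht (hKc.clm_apply (hcont w)) (hcont (K (γ 0) w)) ?_ ?_
    · rw [← tangentEquiv_apply hbase, Ne, LinearEquiv.map_eq_zero_iff]
      exact fun h ↦ hKw ((injective_iff_map_eq_zero _).mp (hinj ht) _ h)
    · filter_upwards [hφ.smooth.eventually_mem_baseSet ht, self_mem_nhdsWithin] with τ hτ hτI
      rw [endCoord_tangentCoord hτ, hs τ hτI, ← tangentEquiv_apply hτ, map_smul]
      rfl
  have hs0 : s 0 = 1 := by
    have h3 := hs 0 (left_mem_Icc.2 zero_le_one) w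
    rw [h0', h0'] at h3
    rcases Int.units_eq_one_or (s 0) with h4 | h4
    · exact h4
    · rw [h4] at h3
      have h5 : (2 : ℝ) • K (γ 0) w = 0 := by
        rw [two_smul]
        exact eq_neg_iff_add_eq_zero.mp (by simpa using h3)
      have h6 := congrArg (fun z ↦ (2⁻¹ : ℝ) • z) h5
      simp only [smul_zero, inv_smul_smul₀ (two_ne_zero' ℝ)] at h6
      exact absurd h6 hKw
  have h3 := hs 1 (right_mem_Icc.2 zero_le_one) v
  rw [h1', h1', hconst, hs0, Units.val_one, Int.cast_one, one_smul] at h3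
  exact h3

theorem IsParallelTransport.map_skewRoot [Nontrivial E] (h₁ : g₁.IsParallel cov)
    (h₂ : g₂.IsParallel cov) {α β : ℝ} (hβ : β ≠ 0)
    (hpair : ∀ x, IsComplexPair α β (g₁.form x).toBilinForm (g₂.form x).toBilinForm)
    {K : ∀ y : M, Module.End ℝ (TangentSpace I y)}
    (hK : ∀ x, IsContinuousEndAt K x ∧ IsMetricSkewRootAt g₁ g₂ K x) {x y : M}
    {φ : TangentSpace I x ≃ₗ[ℝ] TangentSpace I y} (hφ : IsParallelTransport cov φ)
    (v : TangentSpace I x) : K y (φ v) = φ (K x v) := by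
  induction hφ with
  | refl => rfl
  | trans γ _ hψ ih =>
    rw [LinearEquiv.trans_apply, hψ.map_skewRoot h₁ h₂ hβ hpair hK, ih]
    rfl

variable [I.Boundaryless] [T2Space M]

theorem hasReducibleHolonomy_of_two_metrics [SimplyConnectedSpace M] [LocallyPathConnectedSpace M]
    (hcov : CovariantDerivative.ContMDiffCovariantDerivative cov ∞)
    (hdim : Module.finrank ℝ E = 4) (h₁ : g₁.IsParallel cov)
    (h₂ : g₂.IsParallel cov) (hind : SemiRiemannianMetric.Independent ![g₁, g₂]) :
    HasReducibleHolonomy cov := by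
  intro x
  refine actsReducibly_holonomyGroup ?_
  have : Nontrivial E := Module.nontrivial_of_finrank_pos (R := ℝ) (by rw [hdim]; norm_num)
  have hpar : ∀ i, (![g₁, g₂] i).IsParallel cov := by
    intro i
    fin_cases i
    exacts [h₁, h₂]
  have hΦ : ∀ φ ∈ holonomyEnd cov x, ∃ e : TangentSpace I x ≃ₗ[ℝ] TangentSpace I x, φ = e ∧
      (∀ u v, (g₁.form x).toBilinForm (e u) (e v) = (g₁.form x).toBilinForm u v) ∧
      (∀ u v, (g₂.form x).toBilinForm (e u) (e v) = (g₂.form x).toBilinForm u v) := by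
    rintro φ ⟨e, he, rfl⟩
    exact ⟨e, rfl, he.form_eq h₁, he.form_eq h₂⟩
  have hli (p q : ℝ) (hpq : ∀ u v, p * (g₁.form x).toBilinForm u v +
      q * (g₂.form x).toBilinForm u v = 0) : p = 0 ∧ q = 0 := by
    have h := hind.linearIndependent_form hcov hpar x (a := ![p, q]) fun v w ↦ by
      simpa [Fin.sum_univ_two] using hpq v w
    exact ⟨h 0, h 1⟩
  rcases hasInvariantSubspace_or_isComplexPair (b := (g₁.form x).toBilinForm)
    (c := (g₂.form x).toBilinForm) hdim (g₁.symm x) (g₂.symm x) (g₁.nondegenerate x)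
    hli hΦ with h | ⟨α, β, hβ, h⟩
  · exact h
  · have hpair (y : M) :
        IsComplexPair α β (g₁.form y).toBilinForm (g₂.form y).toBilinForm := by
      obtain ⟨P, hP⟩ := exists_isometry hcov h₁ x y
      exact h.map P (hP g₁ h₁) (hP g₂ h₂)
    obtain ⟨K, hK⟩ := exists_continuous_isMetricSkewRootAt hβ hpair
    refine h.hasInvariantSubspace hβ (hK x).2 hΦ ?_
    rintro φ ⟨e, he, rfl⟩
    exact LinearMap.ext fun v ↦ (he.map_skewRoot h₁ h₂ hβ hpair hK v).symm

theorem hasReducibleHolonomy_of_three_metrics [PreconnectedSpace M]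
    (hcov : CovariantDerivative.ContMDiffCovariantDerivative cov ∞)
    (hdim : Module.finrank ℝ E = 4) {g₃ : SemiRiemannianMetric I M} (h₁ : g₁.IsParallel cov)
    (h₂ : g₂.IsParallel cov) (h₃ : g₃.IsParallel cov)
    (hind : SemiRiemannianMetric.Independent ![g₁, g₂, g₃]) :
    HasReducibleHolonomy cov := by
  intro x
  refine actsReducibly_holonomyGroup ?_
  have hpar : ∀ i, (![g₁, g₂, g₃] i).IsParallel cov := by
    intro i
    fin_cases i
    exacts [h₁, h₂, h₃]
  refine hasInvariantSubspace_of_three_forms (b₁ := (g₁.form x).toBilinForm)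
    (b₂ := (g₂.form x).toBilinForm) (b₃ := (g₃.form x).toBilinForm) hdim (g₁.symm x) (g₂.symm x)
    (g₃.symm x) (g₁.nondegenerate x) (fun p q r hpqr ↦ ?_) ?_
  · have h := hind.linearIndependent_form hcov hpar x (a := ![p, q, r]) fun v w ↦ by
      simpa [Fin.sum_univ_three] using hpqr v w
    exact ⟨h 0, h 1, h 2⟩
  · rintro φ ⟨e, he, rfl⟩
    exact ⟨e, rfl, he.form_eq h₁, he.form_eq h₂, he.form_eq h₃⟩

end Holonomy

end

theorem theorem3 {M : Type*} [TopologicalSpace M] [T2Space M]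
    [ChartedSpace (EuclideanSpace ℝ (Fin 4)) M] [IsManifold (𝓡 4) ∞ M]
    (cov : CovariantDerivative (𝓡 4) (EuclideanSpace ℝ (Fin 4))
      (TangentSpace (𝓡 4) : M → Type _))
    (hcov : CovariantDerivative.ContMDiffCovariantDerivative cov ∞) :
    (SimplyConnectedSpace M → ∀ g₁ g₂ : SemiRiemannianMetric (𝓡 4) M,
      SemiRiemannianMetric.Independent ![g₁, g₂] →
      g₁.IsParallel cov → g₂.IsParallel cov → HasReducibleHolonomy cov) ∧
    (ConnectedSpace M → ∀ g₁ g₂ g₃ : SemiRiemannianMetric (𝓡 4) M,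
      SemiRiemannianMetric.Independent ![g₁, g₂, g₃] →
      g₁.IsParallel cov → g₂.IsParallel cov → g₃.IsParallel cov → HasReducibleHolonomy cov) := by
  have hdim : Module.finrank ℝ (EuclideanSpace ℝ (Fin 4)) = 4 := finrank_euclideanSpace_fin
  refine ⟨fun _ g₁ g₂ hind h₁ h₂ ↦ ?_, fun _ g₁ g₂ g₃ hind h₁ h₂ h₃ ↦ ?_⟩
  · have := ChartedSpace.locallyPathConnectedSpace (EuclideanSpace ℝ (Fin 4)) M
    exact hasReducibleHolonomy_of_two_metrics hcov hdim h₁ h₂ hind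
  · exact hasReducibleHolonomy_of_three_metrics hcov hdim h₁ h₂ h₃ hind
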